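/- Theorem. Let $X$ be the metric realization (all edges of length one, intrinsic metric $d_X$) of a rooted, locally finite tree with root $x_0$ and without dead ends, i.e. every point of $X$ lies on a ray (an isometric image of $[0,\infty)$ starting at $x_0$). Let $M(X)$ be the set of classes $[\rho]$ of metrics $\rho$ on $X\sqcup X'$ ($X'=\{x' : x\in X\}$ a second copy of $X$) which restrict to $d_X$ on both copies and for which the copies are at positive distance, where $\rho\sim\sigma$ if $\rho\le\varphi\circ\sigma$ and $\sigma\le\varphi\circ\rho$ off the diagonal for some increasing homeomorphism $\varphi$ of $(0,\infty)$. It is an inverse semigroup with zero under $[\rho][\sigma]=[\rho\circ\sigma]$, $(\rho\circ\sigma)(x,y')=\inf_{u\in X}\,[\sigma(x,u')+1+\rho(u,y')]$, and $[\rho]^*=[\rho^*]$, $\rho^*(x,y')=\rho(y,x')$; its zero is the class of $(x,y')\mapsto d_X(x,a)+1+d_X(a,y)$ for any point $a$. For a ray $r$ let $e_r\in M(X)$ be the class of the metric with $\rho_r(x,y')=\inf_{a\in r}\,[d_X(x,a)+1+d_X(a,y)]$. Let $M(X)_r$ be the semigroup of all $s\in M(X)$ such that both $q=s$ and $q=s^*$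 have the property: for every ray $r$, either $e_rq^*q=0$, or $e_rq^*q=e_r$ and there is a ray $t$ with $qe_r=e_tq$ and $e_tqq^*=e_t$. Let $\partial X$ be the set of rays with the metric $d(\lambda,\mu)=e^{-|\gamma|}$ for $\lambda\ne\mu$, where $|\gamma|$ is the length of the common segment $\gamma$ of $\lambda$ and $\mu$. Let $PBLBL(\partial X)$ be the semigroup, under composition of partial maps, of all bijections $f:A\to B$ between $F_\sigma$ subsets $A,B$ of $\partial X$ such that $f$ and $f^{-1}$ are locally Lipschitz; here a map on $A$ is locally Lipschitz if $A$ is a countable union of compact sets on each of which the map is Lipschitz. Then there is a surjective semigroup homomorphism $\psi:M(X)_r\to PBLBL(\partial X)$ with a right inverse map, i.e. there is a map $\chi:PBLBL(\partial X)\to M(X)_r$ with $\psi\circ\chi=\mathrm{id}$. More precisely, the natural map is such a homomorphism: $\psi(s)$ is defined at a ray $r$ with value $t$ if and only if $e_rs^*s=e_r$, $se_r=e_ts$ and $e_tss^*=e_t$. -/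

import Mathlib

open scoped NNReal

noncomputable section

/-! ### The inverse semigroup `M(X)` of metrics on the double of a metric space -/

/-- A metric on the double `X ⊔ X` (realised as `X ⊕ X`; `Sum.inl x` is `x` and `Sum.inr x` is `x'`)
which is compatible with the metric of `X`, i.e. restricts to it on both copies, and for which the
two copies are at positive distance. -/
structure DoubleMetric (X : Type*) [MetricSpace X] where
  d : X ⊕ X → X ⊕ X → ℝ
  d_self : ∀ p, d p p = 0
  eq_of_d_eq_zero : ∀ p q, d p q = 0 → p = q
  d_comm : ∀ p q, d p q = d q p
  d_triangle : ∀ p q r, d p r ≤ d p q + d q r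
  d_inl : ∀ x y, d (Sum.inl x) (Sum.inl y) = dist x y
  d_inr : ∀ x y, d (Sum.inr x) (Sum.inr y) = dist x y
  gap : ∃ c : ℝ, 0 < c ∧ ∀ x y, c ≤ d (Sum.inl x) (Sum.inr y)

namespace DoubleMetric

variable {X : Type*} [MetricSpace X]

/-- The distance `ρ(x, y')` between points of different copies. -/
def cross (ρ : DoubleMetric X) (x y : X) : ℝ := ρ.d (Sum.inl x) (Sum.inr y)

/-- A compatible metric is determined by its values `ρ(x, y')`. -/
def ofCross (k : X → X → ℝ)
    (h1 : ∀ x x' y, k x y ≤ dist x x' + k x' y)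
    (h2 : ∀ x y y', k x y ≤ k x y' + dist y' y)
    (h3 : ∀ x x' y, dist x x' ≤ k x y + k x' y)
    (h4 : ∀ x y y', dist y y' ≤ k x y + k x y')
    (hgap : ∃ c : ℝ, 0 < c ∧ ∀ x y, c ≤ k x y) : DoubleMetric X where
  d p q := match p, q with
    | Sum.inl x, Sum.inl y => dist x y
    | Sum.inr x, Sum.inr y => dist x y
    | Sum.inl x, Sum.inr y => k x y
    | Sum.inr x, Sum.inl y => k y x
  d_self p := by cases p <;> simp
  eq_of_d_eq_zero p q h := by
    obtain ⟨c, hc, hk⟩ := hgap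
    rcases p with x | x <;> rcases q with y | y
    · simpa using h
    · have := hk x y
      simp only at h
      linarith
    · have := hk y x
      simp only at h
      linarith
    · simpa using h
  d_comm p q := by
    cases p <;> cases q <;> simp [dist_comm]
  d_triangle p q r := by
    rcases p with x | x <;> rcases q with y | y <;> rcases r with z | z <;> simp only
    · exact dist_triangle x y z
    · exact h1 x y z
    · exact h3 x z y
    · exact h2 x z y
    · have := h1 z y x
      rw [dist_comm] at this
      linarith
    · exact h4 y x z
    · have := h2 z x y
      rw [dist_comm] at this
      linarith
    · exact dist_triangle x y z
  d_inl x y := rfl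
  d_inr x y := rfl
  gap := hgap

@[simp] lemma cross_ofCross (k : X → X → ℝ) (h1 h2 h3 h4 hgap) (x y : X) :
    (ofCross k h1 h2 h3 h4 hgap).cross x y = k x y := rfl

section basic

variable (ρ : DoubleMetric X)

lemma cross_le_left (x x' y : X) : ρ.cross x y ≤ dist x x' + ρ.cross x' y := by
  have := ρ.d_triangle (Sum.inl x) (Sum.inl x') (Sum.inr y)
  rwa [ρ.d_inl] at this

lemma cross_le_right (x y y' : X) : ρ.cross x y ≤ ρ.cross x y' + dist y' y := by
  have := ρ.d_triangle (Sum.inl x) (Sum.inr y') (Sum.inr y)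
  rwa [ρ.d_inr] at this

lemma dist_le_left (x x' y : X) : dist x x' ≤ ρ.cross x y + ρ.cross x' y := by
  have := ρ.d_triangle (Sum.inl x) (Sum.inr y) (Sum.inl x')
  rwa [ρ.d_inl, ρ.d_comm (Sum.inr y)] at this

lemma dist_le_right (x y y' : X) : dist y y' ≤ ρ.cross x y + ρ.cross x y' := by
  have := ρ.d_triangle (Sum.inr y) (Sum.inl x) (Sum.inr y')
  rwa [ρ.d_inr, ρ.d_comm (Sum.inr y)] at this

lemma gap_cross : ∃ c : ℝ, 0 < c ∧ ∀ x y, c ≤ ρ.cross x y := ρ.gap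

lemma cross_nonneg (x y : X) : 0 ≤ ρ.cross x y := by
  obtain ⟨c, hc, h⟩ := ρ.gap_cross
  exact hc.le.trans (h x y)

end basic

/-- The composition `ρ ∘ σ`, with `(ρ ∘ σ)(x, y') = inf_u [σ(x, u') + 1 + ρ(u, y')]`. -/
def comp (ρ σ : DoubleMetric X) : DoubleMetric X :=
  have bdd : ∀ x y, BddBelow (Set.range fun u => σ.cross x u + 1 + ρ.cross u y) := fun x y =>
    ⟨0, by rintro _ ⟨u, rfl⟩; have := σ.cross_nonneg x u; have := ρ.cross_nonneg u y; positivity⟩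
  ofCross (fun x y => ⨅ u, (σ.cross x u + 1 + ρ.cross u y))
    (fun x x' y => by
      have : Nonempty X := ⟨x⟩
      rw [← sub_le_iff_le_add']
      refine le_ciInf fun u => ?_
      rw [sub_le_iff_le_add']
      refine (ciInf_le (bdd x y) u).trans ?_
      have := σ.cross_le_left x x' u
      linarith)
    (fun x y y' => by
      have : Nonempty X := ⟨x⟩
      rw [← sub_le_iff_le_add]
      refine le_ciInf fun u => ?_
      rw [sub_le_iff_le_add]
      refine (ciInf_le (bdd x y) u).trans ?_
      have := ρ.cross_le_right u y y'
      linarith)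
    (fun x x' y => by
      have : Nonempty X := ⟨x⟩
      rw [← sub_le_iff_le_add]
      refine le_ciInf fun u => ?_
      rw [sub_le_iff_le_add, ← sub_le_iff_le_add']
      refine le_ciInf fun v => ?_
      rw [sub_le_iff_le_add']
      have h1 := σ.dist_le_left x x' u
      have h2 := σ.cross_le_right x' u v
      have h3 := ρ.dist_le_left v u y
      linarith)
    (fun x y y' => by
      have : Nonempty X := ⟨x⟩
      rw [← sub_le_iff_le_add]
      refine le_ciInf fun u => ?_
      rw [sub_le_iff_le_add, ← sub_le_iff_le_add']
      refine le_ciInf fun v => ?_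
      rw [sub_le_iff_le_add']
      have h1 := ρ.dist_le_right u y y'
      have h2 := ρ.cross_le_left u v y'
      have h3 := σ.dist_le_right x u v
      linarith)
    ⟨1, one_pos, fun x y => by
      have : Nonempty X := ⟨x⟩
      refine le_ciInf fun u => ?_
      have := σ.cross_nonneg x u
      have := ρ.cross_nonneg u y
      linarith⟩

lemma comp_cross (ρ σ : DoubleMetric X) (x y : X) :
    (comp ρ σ).cross x y = ⨅ u, (σ.cross x u + 1 + ρ.cross u y) := rfl

lemma comp_cross_le (ρ σ : DoubleMetric X) (x y u : X) :
    (comp ρ σ).cross x y ≤ σ.cross x u + 1 + ρ.cross u y := by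
  rw [comp_cross]
  refine ciInf_le ⟨0, ?_⟩ u
  rintro _ ⟨u, rfl⟩
  have := σ.cross_nonneg x u
  have := ρ.cross_nonneg u y
  positivity

lemma le_comp_cross (ρ σ : DoubleMetric X) (x y : X) (c : ℝ)
    (h : ∀ u, c ≤ σ.cross x u + 1 + ρ.cross u y) : c ≤ (comp ρ σ).cross x y := by
  have : Nonempty X := ⟨x⟩
  exact le_ciInf h

lemma one_le_comp_cross (ρ σ : DoubleMetric X) (x y : X) : 1 ≤ (comp ρ σ).cross x y := by
  refine le_comp_cross ρ σ x y 1 fun u => ?_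
  have := σ.cross_nonneg x u
  have := ρ.cross_nonneg u y
  linarith

/-- The adjoint metric, `ρ*(x, y') = ρ(y, x')`. -/
def adjoint (ρ : DoubleMetric X) : DoubleMetric X :=
  ofCross (fun x y => ρ.cross y x)
    (fun x x' y => by
      have := ρ.cross_le_right y x x'
      rw [dist_comm] at this
      linarith)
    (fun x y y' => by
      have := ρ.cross_le_left y y' x
      rw [dist_comm] at this
      linarith)
    (fun x x' y => ρ.dist_le_right y x x')
    (fun x y y' => ρ.dist_le_left y y' x)
    (by
      obtain ⟨c, hc, h⟩ := ρ.gap_cross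
      exact ⟨c, hc, fun x y => h y x⟩)

lemma adjoint_cross (ρ : DoubleMetric X) (x y : X) : ρ.adjoint.cross x y = ρ.cross y x := rfl

/-- The metric `ρ_A(x, y') = inf_{a ∈ A} [d(x, a) + 1 + d(a, y)]` of a nonempty set `A`. -/
def ofSet (A : Set X) (hA : A.Nonempty) : DoubleMetric X :=
  have : Nonempty A := hA.to_subtype
  have bdd : ∀ x y : X, BddBelow (Set.range fun a : A => dist x (a : X) + 1 + dist (a : X) y) :=
    fun x y => ⟨0, by rintro _ ⟨u, rfl⟩; positivity⟩
  ofCross (fun x y => ⨅ a : A, (dist x (a : X) + 1 + dist (a : X) y))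
    (fun x x' y => by
      rw [← sub_le_iff_le_add']
      refine le_ciInf fun a => ?_
      rw [sub_le_iff_le_add']
      refine (ciInf_le (bdd x y) a).trans ?_
      have := dist_triangle x x' a
      linarith)
    (fun x y y' => by
      rw [← sub_le_iff_le_add]
      refine le_ciInf fun a => ?_
      rw [sub_le_iff_le_add]
      refine (ciInf_le (bdd x y) a).trans ?_
      have := dist_triangle (a : X) y' y
      linarith)
    (fun x x' y => by
      rw [← sub_le_iff_le_add]
      refine le_ciInf fun a => ?_
      rw [sub_le_iff_le_add, ← sub_le_iff_le_add']
      refine le_ciInf fun b => ?_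
      rw [sub_le_iff_le_add']
      have h1 := dist_triangle4 x a y b
      have h2 := dist_triangle x b x'
      rw [dist_comm (b : X) x'] at h2
      rw [dist_comm y (b : X)] at h1
      linarith)
    (fun x y y' => by
      rw [← sub_le_iff_le_add]
      refine le_ciInf fun a => ?_
      rw [sub_le_iff_le_add, ← sub_le_iff_le_add']
      refine le_ciInf fun b => ?_
      rw [sub_le_iff_le_add']
      have h1 := dist_triangle4 y a x b
      have h2 := dist_triangle y b y'
      rw [dist_comm y (a : X), dist_comm (a : X) x] at h1
      linarith)
    ⟨1, one_pos, fun x y => le_ciInf fun a => by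
      have h1 := dist_nonneg (x := x) (y := (a : X))
      have h2 := dist_nonneg (x := (a : X)) (y := y)
      linarith⟩

lemma ofSet_cross (A : Set X) (hA : A.Nonempty) (x y : X) :
    (ofSet A hA).cross x y = ⨅ a : A, (dist x (a : X) + 1 + dist (a : X) y) := rfl

lemma adjoint_ofSet (A : Set X) (hA : A.Nonempty) (x y : X) :
    (ofSet A hA).adjoint.cross x y = (ofSet A hA).cross x y := by
  rw [adjoint_cross, ofSet_cross, ofSet_cross]
  congr 1
  ext a
  rw [dist_comm y, dist_comm x]
  ring

lemma ofSet_singleton_cross (a x y : X) :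
    (ofSet {a} (Set.singleton_nonempty a)).cross x y = dist x a + 1 + dist a y := by
  rw [ofSet_cross]
  simp

/-- Coarse equivalence of compatible metrics: there is an increasing homeomorphism `φ` of `(0, ∞)`
(written as an order automorphism of `[0, ∞)`, which automatically fixes `0`) such that
`ρ ≤ φ ∘ σ` and `σ ≤ φ ∘ ρ`. -/
def CoarseEquiv (ρ σ : DoubleMetric X) : Prop :=
  ∃ φ : ℝ≥0 ≃o ℝ≥0, ∀ p q : X ⊕ X,
    ρ.d p q ≤ φ (σ.d p q).toNNReal ∧ σ.d p q ≤ φ (ρ.d p q).toNNReal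

/-- A convenient way of producing order automorphisms of `[0, ∞)`. -/
lemma exists_orderIso (θ : ℝ≥0 → ℝ≥0) (hc : Continuous θ) (hm : StrictMono θ) (h0 : θ 0 = 0)
    (hid : ∀ t, t ≤ θ t) : ∃ φ : ℝ≥0 ≃o ℝ≥0, ∀ t, φ t = θ t := by
  have hs : Function.Surjective θ := fun t =>
    mem_range_of_exists_le_of_exists_ge hc ⟨0, by simp [h0]⟩ ⟨t, hid t⟩
  exact ⟨StrictMono.orderIsoOfSurjective θ hm hs, fun t => rfl⟩

lemma d_nonneg (ρ : DoubleMetric X) (p q : X ⊕ X) : 0 ≤ ρ.d p q := by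
  have h := ρ.d_triangle p q p
  rw [ρ.d_self, ρ.d_comm q p] at h
  linarith

lemma coarseEquiv_of_cross (ρ σ : DoubleMetric X) (θ : ℝ≥0 → ℝ≥0) (hc : Continuous θ)
    (hm : StrictMono θ) (h0 : θ 0 = 0) (hid : ∀ t, t ≤ θ t)
    (h1 : ∀ x y, ρ.cross x y ≤ θ (σ.cross x y).toNNReal)
    (h2 : ∀ x y, σ.cross x y ≤ θ (ρ.cross x y).toNNReal) : CoarseEquiv ρ σ := by
  obtain ⟨φ, hφ⟩ := exists_orderIso θ hc hm h0 hid
  have key : ∀ t : ℝ, t ≤ θ t.toNNReal := fun t =>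
    (Real.le_coe_toNNReal t).trans (by exact_mod_cast hid t.toNNReal)
  refine ⟨φ, fun p q => ?_⟩
  simp only [hφ]
  rcases p with x | x <;> rcases q with y | y
  · rw [ρ.d_inl, σ.d_inl]
    exact ⟨key _, key _⟩
  · exact ⟨h1 x y, h2 x y⟩
  · rw [ρ.d_comm, σ.d_comm]
    exact ⟨h1 y x, h2 y x⟩
  · rw [ρ.d_inr, σ.d_inr]
    exact ⟨key _, key _⟩

lemma coarseEquiv_of_linear (ρ σ : DoubleMetric X) (K : ℝ) (hK : 1 ≤ K)
    (h1 : ∀ x y, ρ.cross x y ≤ K * σ.cross x y)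
    (h2 : ∀ x y, σ.cross x y ≤ K * ρ.cross x y) : CoarseEquiv ρ σ := by
  lift K to ℝ≥0 using by linarith
  have hK1 : 1 ≤ K := by exact_mod_cast hK
  refine coarseEquiv_of_cross ρ σ (fun t => K * t) (by fun_prop) ?_ (by simp) ?_ ?_ ?_
  · intro a b hab
    exact mul_lt_mul_of_pos_left hab (lt_of_lt_of_le one_pos hK1)
  · intro t
    exact le_mul_of_one_le_left (zero_le) hK1
  · intro x y
    rw [NNReal.coe_mul, Real.coe_toNNReal _ (σ.cross_nonneg x y)]
    exact h1 x y
  · intro x y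
    rw [NNReal.coe_mul, Real.coe_toNNReal _ (ρ.cross_nonneg x y)]
    exact h2 x y

lemma coarseEquiv_of_eq (ρ σ : DoubleMetric X) (h : ∀ x y, ρ.cross x y = σ.cross x y) :
    CoarseEquiv ρ σ :=
  coarseEquiv_of_linear ρ σ 1 le_rfl (fun x y => by rw [h, one_mul]) (fun x y => by rw [h, one_mul])

lemma CoarseEquiv.cross_le {ρ σ : DoubleMetric X} {φ : ℝ≥0 ≃o ℝ≥0}
    (h : ∀ p q : X ⊕ X, ρ.d p q ≤ φ (σ.d p q).toNNReal) (x y : X) {t : ℝ≥0}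
    (ht : σ.cross x y ≤ t) : ρ.cross x y ≤ φ t := by
  refine (h _ _).trans ?_
  have : (σ.d (Sum.inl x) (Sum.inr y)).toNNReal ≤ t := Real.toNNReal_le_iff_le_coe.2 ht
  exact_mod_cast φ.monotone this

instance setoid (X : Type*) [MetricSpace X] : Setoid (DoubleMetric X) where
  r := CoarseEquiv
  iseqv :=
    { refl := fun ρ => coarseEquiv_of_eq ρ ρ fun _ _ => rfl
      symm := fun ⟨φ, h⟩ => ⟨φ, fun p q => ⟨(h p q).2, (h p q).1⟩⟩
      trans := by
        rintro ρ σ τ ⟨φ, h⟩ ⟨ψ, k⟩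
        refine coarseEquiv_of_cross ρ τ (fun t => φ (ψ t) + ψ (φ t) + t) ?_ ?_ ?_ ?_ ?_ ?_
        · have := φ.continuous
          have := ψ.continuous
          fun_prop
        · intro a b hab
          exact add_lt_add (add_lt_add (φ.strictMono (ψ.strictMono hab))
            (ψ.strictMono (φ.strictMono hab))) hab
        · have h1 : φ 0 = 0 := φ.map_bot
          have h2 : ψ 0 = 0 := ψ.map_bot
          simp [h1, h2]
        · intro t
          exact le_add_self
        · intro x y
          refine (CoarseEquiv.cross_le (fun p q => (h p q).1) x y
            (CoarseEquiv.cross_le (fun p q => (k p q).1) x y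
              (Real.le_coe_toNNReal _))).trans ?_
          push_cast
          have := (ψ (φ (τ.cross x y).toNNReal)).coe_nonneg
          have := (τ.cross x y).toNNReal.coe_nonneg
          linarith
        · intro x y
          refine (CoarseEquiv.cross_le (fun p q => (k p q).2) x y
            (CoarseEquiv.cross_le (fun p q => (h p q).2) x y
              (Real.le_coe_toNNReal _))).trans ?_
          push_cast
          have := (φ (ψ (ρ.cross x y).toNNReal)).coe_nonneg
          have := (ρ.cross x y).toNNReal.coe_nonneg
          linarith }

lemma comp_congr_le {ρ₁ ρ₂ σ₁ σ₂ : DoubleMetric X} {φ ψ : ℝ≥0 ≃o ℝ≥0}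
    (h : ∀ p q : X ⊕ X, ρ₁.d p q ≤ φ (ρ₂.d p q).toNNReal)
    (k : ∀ p q : X ⊕ X, σ₁.d p q ≤ ψ (σ₂.d p q).toNNReal) (x y : X) :
    (comp ρ₁ σ₁).cross x y ≤
      ((φ (2 * ((comp ρ₂ σ₂).cross x y).toNNReal) + ψ (2 * ((comp ρ₂ σ₂).cross x y).toNNReal)
        + ((comp ρ₂ σ₂).cross x y).toNNReal : ℝ≥0) : ℝ) := by
  have hone := one_le_comp_cross ρ₂ σ₂ x y
  obtain ⟨u, hu⟩ : ∃ u, σ₂.cross x u + 1 + ρ₂.cross u y < 2 * (comp ρ₂ σ₂).cross x y := by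
    by_contra! hcon
    have := le_comp_cross ρ₂ σ₂ x y _ hcon
    linarith
  have hco : ((2 * ((comp ρ₂ σ₂).cross x y).toNNReal : ℝ≥0) : ℝ)
      = 2 * (comp ρ₂ σ₂).cross x y := by
    rw [NNReal.coe_mul, Real.coe_toNNReal _ (by linarith)]
    rfl
  have h1 := σ₂.cross_nonneg x u
  have h2 := ρ₂.cross_nonneg u y
  have h3 := CoarseEquiv.cross_le k x u
    (t := 2 * ((comp ρ₂ σ₂).cross x y).toNNReal) (by rw [hco]; linarith)
  have h4 := CoarseEquiv.cross_le h u y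
    (t := 2 * ((comp ρ₂ σ₂).cross x y).toNNReal) (by rw [hco]; linarith)
  have h5 := comp_cross_le ρ₁ σ₁ x y u
  have h6 := Real.le_coe_toNNReal ((comp ρ₂ σ₂).cross x y)
  push_cast at h3 h4 ⊢
  linarith

lemma comp_congr {ρ₁ ρ₂ σ₁ σ₂ : DoubleMetric X} (h : ρ₁ ≈ ρ₂) (k : σ₁ ≈ σ₂) :
    comp ρ₁ σ₁ ≈ comp ρ₂ σ₂ := by
  obtain ⟨φ, h⟩ := h
  obtain ⟨ψ, k⟩ := k
  refine coarseEquiv_of_cross _ _ (fun t => φ (2 * t) + ψ (2 * t) + t) ?_ ?_ ?_ ?_ ?_ ?_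
  · have := φ.continuous
    have := ψ.continuous
    fun_prop
  · intro a b hab
    have h2 : 2 * a < 2 * b := mul_lt_mul_of_pos_left hab two_pos
    exact add_lt_add (add_lt_add (φ.strictMono h2) (ψ.strictMono h2)) hab
  · have h1 : φ 0 = 0 := φ.map_bot
    have h2 : ψ 0 = 0 := ψ.map_bot
    simp [h1, h2]
  · intro t
    exact le_add_self
  · exact comp_congr_le (fun p q => (h p q).1) (fun p q => (k p q).1)
  · exact comp_congr_le (fun p q => (h p q).2) (fun p q => (k p q).2)

lemma adjoint_congr {ρ σ : DoubleMetric X} (h : ρ ≈ σ) : ρ.adjoint ≈ σ.adjoint := by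
  obtain ⟨φ, h⟩ := h
  refine coarseEquiv_of_cross _ _ (fun t => φ t + t) ?_ ?_ ?_ ?_ ?_ ?_
  · have := φ.continuous
    fun_prop
  · intro a b hab
    exact add_lt_add (φ.strictMono hab) hab
  · have h1 : φ 0 = 0 := φ.map_bot
    simp [h1]
  · intro t
    exact le_add_self
  · intro x y
    refine (CoarseEquiv.cross_le (fun p q => (h p q).1) y x (Real.le_coe_toNNReal _)).trans ?_
    push_cast
    have := (σ.adjoint.cross x y).toNNReal.coe_nonneg
    rw [adjoint_cross] at *
    linarith
  · intro x y
    refine (CoarseEquiv.cross_le (fun p q => (h p q).2) y x (Real.le_coe_toNNReal _)).trans ?_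
    push_cast
    have := (ρ.adjoint.cross x y).toNNReal.coe_nonneg
    rw [adjoint_cross] at *
    linarith

lemma comp_assoc_cross (ρ σ τ : DoubleMetric X) (x y : X) :
    (comp (comp ρ σ) τ).cross x y = (comp ρ (comp σ τ)).cross x y := by
  apply le_antisymm
  · refine le_comp_cross _ _ _ _ _ fun v => ?_
    rw [← sub_le_iff_le_add, ← sub_le_iff_le_add]
    refine le_comp_cross _ _ _ _ _ fun u => ?_
    have h1 := comp_cross_le (comp ρ σ) τ x y u
    have h2 := comp_cross_le ρ σ u y v
    linarith
  · refine le_comp_cross _ _ _ _ _ fun u => ?_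
    rw [← sub_le_iff_le_add']
    refine le_comp_cross _ _ _ _ _ fun v => ?_
    have h1 := comp_cross_le ρ (comp σ τ) x y v
    have h2 := comp_cross_le σ τ x v u
    linarith

lemma adjoint_comp_cross (ρ σ : DoubleMetric X) (x y : X) :
    (comp ρ σ).adjoint.cross x y = (comp σ.adjoint ρ.adjoint).cross x y := by
  rw [adjoint_cross, comp_cross, comp_cross]
  congr 1
  ext u
  rw [adjoint_cross, adjoint_cross]
  ring

lemma comp_adjoint_comp (ρ : DoubleMetric X) : comp (comp ρ ρ.adjoint) ρ ≈ ρ := by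
  obtain ⟨c, hc, hgap⟩ := ρ.gap_cross
  have hpos : 0 < 2 / c := by positivity
  refine coarseEquiv_of_linear _ _ (3 + 2 / c) (by linarith) ?_ ?_
  · intro x y
    have h1 := comp_cross_le (comp ρ ρ.adjoint) ρ x y y
    have h2 := comp_cross_le ρ ρ.adjoint y y x
    rw [adjoint_cross] at h2
    have h3 : 2 ≤ 2 / c * ρ.cross x y := by
      calc (2 : ℝ) = 2 / c * c := by field_simp
        _ ≤ _ := mul_le_mul_of_nonneg_left (hgap x y) hpos.le
    linarith
  · intro x y
    have h0 : ρ.cross x y ≤ (comp (comp ρ ρ.adjoint) ρ).cross x y := by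
      refine le_comp_cross _ _ _ _ _ fun u => ?_
      rw [← sub_le_iff_le_add']
      refine le_comp_cross _ _ _ _ _ fun v => ?_
      rw [adjoint_cross]
      have h1 := ρ.cross_le_left x v y
      have h2 := ρ.dist_le_left x v u
      linarith
    have h1 := (comp (comp ρ ρ.adjoint) ρ).cross_nonneg x y
    nlinarith [mul_nonneg hpos.le h1]

lemma comp_singleton (a : X) (σ : DoubleMetric X) :
    comp (ofSet {a} (Set.singleton_nonempty a)) σ ≈ ofSet {a} (Set.singleton_nonempty a) := by
  have ha := σ.cross_nonneg a a
  refine coarseEquiv_of_linear _ _ (σ.cross a a + 2) (by linarith) ?_ ?_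
  · intro x y
    have h1 := comp_cross_le (ofSet {a} (Set.singleton_nonempty a)) σ x y a
    have h2 := σ.cross_le_left x a a
    rw [ofSet_singleton_cross, dist_self] at h1
    rw [ofSet_singleton_cross]
    have h3 := dist_nonneg (x := x) (y := a)
    have h4 := dist_nonneg (x := a) (y := y)
    nlinarith [mul_nonneg ha h3, mul_nonneg ha h4]
  · intro x y
    have h1 : dist x a + 1 + dist a y ≤
        (comp (ofSet {a} (Set.singleton_nonempty a)) σ).cross x y + σ.cross a a := by
      rw [← sub_le_iff_le_add]
      refine le_comp_cross _ _ _ _ _ fun u => ?_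
      rw [ofSet_singleton_cross]
      have h1 := σ.dist_le_left x a u
      have h2 := σ.cross_le_right a u a
      rw [dist_comm a u] at h2
      linarith
    rw [ofSet_singleton_cross]
    have h2 := one_le_comp_cross (ofSet {a} (Set.singleton_nonempty a)) σ x y
    nlinarith [mul_nonneg ha (sub_nonneg.2 h2)]

end DoubleMetric

/-- `M(X)`: coarse equivalence classes of compatible metrics on the double of `X`. -/
def MetricClass (X : Type*) [MetricSpace X] : Type _ := Quotient (DoubleMetric.setoid X)

namespace MetricClass

variable {X : Type*} [MetricSpace X]

/-- The class `[ρ]`. -/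
def mk (ρ : DoubleMetric X) : MetricClass X := Quotient.mk _ ρ

/-- The class `[ρ_A]` of a nonempty set `A`. -/
def ofSet (A : Set X) (hA : A.Nonempty) : MetricClass X := mk (DoubleMetric.ofSet A hA)

/-- `[ρ][σ] = [ρ ∘ σ]`. -/
instance : Mul (MetricClass X) :=
  ⟨Quotient.map₂ DoubleMetric.comp fun _ _ h _ _ k => DoubleMetric.comp_congr h k⟩

/-- `[ρ]* = [ρ*]`. -/
instance : Star (MetricClass X) :=
  ⟨Quotient.map DoubleMetric.adjoint fun _ _ h => DoubleMetric.adjoint_congr h⟩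

lemma mk_eq {ρ σ : DoubleMetric X} (h : ρ ≈ σ) : mk ρ = mk σ := Quotient.sound h

lemma star_ofSet (A : Set X) (hA : A.Nonempty) : star (ofSet A hA) = ofSet A hA :=
  mk_eq (DoubleMetric.coarseEquiv_of_eq _ _ (DoubleMetric.adjoint_ofSet A hA))

lemma mul_star_mul (s : MetricClass X) : s * star s * s = s := by
  induction s using Quotient.inductionOn with
  | h ρ => exact mk_eq (DoubleMetric.comp_adjoint_comp ρ)

instance : Semigroup (MetricClass X) where
  mul_assoc s t u := by
    induction s using Quotient.inductionOn with
    | h ρ =>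
      induction t using Quotient.inductionOn with
      | h σ =>
        induction u using Quotient.inductionOn with
        | h τ =>
          exact mk_eq (DoubleMetric.coarseEquiv_of_eq _ _ (DoubleMetric.comp_assoc_cross ρ σ τ))

instance : StarMul (MetricClass X) where
  star_involutive s := by
    induction s using Quotient.inductionOn with
    | h ρ => exact mk_eq (DoubleMetric.coarseEquiv_of_eq _ _ fun _ _ => rfl)
  star_mul s t := by
    induction s using Quotient.inductionOn with
    | h ρ =>
      induction t using Quotient.inductionOn with
      | h σ =>
        exact mk_eq (DoubleMetric.coarseEquiv_of_eq _ _ (DoubleMetric.adjoint_comp_cross ρ σ))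

/-- The zero of `M(X)` is the class `[ρ_{a}]` of a point `a ∈ X`. -/
instance [Nonempty X] : SemigroupWithZero (MetricClass X) where
  zero := ofSet {Classical.arbitrary X} (Set.singleton_nonempty _)
  zero_mul s := by
    induction s using Quotient.inductionOn with
    | h ρ => exact mk_eq (DoubleMetric.comp_singleton _ ρ)
  mul_zero s := by
    change s * ofSet {Classical.arbitrary X} (Set.singleton_nonempty _) =
      ofSet {Classical.arbitrary X} (Set.singleton_nonempty _)
    have h : ∀ t : MetricClass X, ofSet {Classical.arbitrary X} (Set.singleton_nonempty _) * t =
        ofSet {Classical.arbitrary X} (Set.singleton_nonempty _) := by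
      intro t
      induction t using Quotient.inductionOn with
      | h ρ => exact mk_eq (DoubleMetric.comp_singleton _ ρ)
    have h' := congrArg star (h (star s))
    rwa [star_mul, star_star, star_ofSet] at h'

end MetricClass

/-! ### The subsemigroup `S_Φ` associated with a set `Φ` of idempotents -/

section Restricted

variable {S : Type*} [SemigroupWithZero S] [StarMul S]

/-- The set `S(Φ)`: those `s` such that for every `e ∈ Φ` either `e s* s = 0`, or `e s* s = e` and
there is `f ∈ Φ` with `s e = f s` and `f s s* = f`. -/
def halfRestricted (Φ : Set S) : Set S :=
  {s | ∀ e ∈ Φ, e * star s * s = 0 ∨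
    (e * star s * s = e ∧ ∃ f ∈ Φ, s * e = f * s ∧ f * s * star s = f)}

lemma halfRestricted_mul (hreg : ∀ s : S, s * star s * s = s) (Φ : Set S)
    (hΦ : ∀ e ∈ Φ, star e = e) {s t : S} (hs : s ∈ halfRestricted Φ) (ht : t ∈ halfRestricted Φ) :
    s * t ∈ halfRestricted Φ := by
  intro e he
  rcases ht e he with h0 | ⟨h1, f, hf, h2, h3⟩
  · left
    have hr := hreg (star t)
    rw [star_star] at hr
    calc e * star (s * t) * (s * t) = e * star t * (star s * s * t) := by
          simp only [star_mul, mul_assoc]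
      _ = e * (star t * t * star t) * (star s * s * t) := by rw [hr]
      _ = (e * star t * t) * (star t * (star s * s * t)) := by simp only [mul_assoc]
      _ = 0 := by rw [h0, zero_mul]
  · have hst : e * star t = star t * f := by
      have := congrArg star h2
      rwa [star_mul, star_mul, hΦ e he, hΦ f hf] at this
    have hcomp : e * star (s * t) * (s * t) = star t * (f * star s * s) * t := by
      calc e * star (s * t) * (s * t) = (e * star t) * (star s * s * t) := by
            simp only [star_mul, mul_assoc]
        _ = _ := by rw [hst]; simp only [mul_assoc]
    rcases hs f hf with g0 | ⟨g1, g, hg, g2, g3⟩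
    · left
      rw [hcomp, g0, mul_zero, zero_mul]
    · right
      refine ⟨?_, g, hg, ?_, ?_⟩
      · rw [hcomp, g1, mul_assoc, ← h2, ← mul_assoc]
        have := congrArg star h1
        rwa [star_mul, star_mul, star_star, hΦ e he, ← mul_assoc] at this
      · rw [mul_assoc, h2, ← mul_assoc, g2, mul_assoc]
      · calc g * (s * t) * star (s * t) = (g * s) * t * star t * star s := by
              simp only [star_mul, mul_assoc]
          _ = s * (f * t * star t) * star s := by rw [← g2]; simp only [mul_assoc]
          _ = g := by rw [h3, g2, g3]

/-- The semigroup `S_Φ = S(Φ) ∩ S(Φ)*`. -/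
def restrictedSubsemigroup (hreg : ∀ s : S, s * star s * s = s) (Φ : Set S)
    (hΦ : ∀ e ∈ Φ, star e = e) : Subsemigroup S where
  carrier := {s | s ∈ halfRestricted Φ ∧ star s ∈ halfRestricted Φ}
  mul_mem' := by
    rintro s t ⟨hs, hs'⟩ ⟨ht, ht'⟩
    refine ⟨halfRestricted_mul hreg Φ hΦ hs ht, ?_⟩
    rw [star_mul]
    exact halfRestricted_mul hreg Φ hΦ ht' hs'

end Restricted

/-! ### Geodesic rays, the boundary and `M(X)_r` -/

/-- Geodesic rays starting at `x₀`: isometric maps `[0, ∞) → X` sending `0` to `x₀`. -/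
def Ray {X : Type*} [MetricSpace X] (x₀ : X) : Type _ :=
  {r : ℝ≥0 → X // Isometry r ∧ r 0 = x₀}

namespace Ray

variable {X : Type*} [MetricSpace X] {x₀ : X}

/-- The image of a ray. -/
def image (r : Ray x₀) : Set X := Set.range r.1

/-- The idempotent `[ρ_r]` of a ray. -/
def idem (r : Ray x₀) : MetricClass X := MetricClass.ofSet r.image (Set.range_nonempty _)

/-- The length of the common initial segment of two distinct rays. -/
def common (r s : Ray x₀) : ℝ≥0 := sSup {t | ∀ u ≤ t, r.1 u = s.1 u}

lemma common_comm (r s : Ray x₀) : common r s = common s r := by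
  unfold common
  simp only [eq_comm]

lemma bddAbove_common {r s : Ray x₀} (h : r ≠ s) :
    BddAbove {t : ℝ≥0 | ∀ u ≤ t, r.1 u = s.1 u} := by
  obtain ⟨v, hv⟩ : ∃ v, r.1 v ≠ s.1 v := by
    by_contra! hcon
    exact h (Subtype.ext (funext hcon))
  refine ⟨v, fun t ht => ?_⟩
  by_contra! hlt
  exact hv (ht v hlt.le)

lemma min_common_le {r s q : Ray x₀} (h : r ≠ q) :
    min (common r s) (common s q) ≤ common r q := by
  by_contra! hlt
  rw [lt_min_iff] at hlt
  obtain ⟨a, ha, hac⟩ := exists_lt_of_lt_csSup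
    (s := {t : ℝ≥0 | ∀ u ≤ t, r.1 u = s.1 u})
    ⟨0, fun u hu => by rw [nonpos_iff_eq_zero.1 hu, r.2.2, s.2.2]⟩ hlt.1
  obtain ⟨b, hb, hbc⟩ := exists_lt_of_lt_csSup
    (s := {t : ℝ≥0 | ∀ u ≤ t, s.1 u = q.1 u})
    ⟨0, fun u hu => by rw [nonpos_iff_eq_zero.1 hu, s.2.2, q.2.2]⟩ hlt.2
  have : min a b ≤ common r q := le_csSup (bddAbove_common h) fun u hu =>
    (ha u (hu.trans (min_le_left _ _))).trans (hb u (hu.trans (min_le_right _ _)))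
  exact absurd this (not_le.2 (lt_min hac hbc))

open Classical in
/-- The metric `d(λ, μ) = e^{-|γ|}`, with `γ` the common segment of the distinct rays `λ` and `μ`. -/
instance : MetricSpace (Ray x₀) where
  dist r s := if r = s then 0 else Real.exp (-(common r s : ℝ))
  dist_self r := by simp
  dist_comm r s := by simp [eq_comm, common_comm r s]
  dist_triangle r s q := by
    by_cases h1 : r = q
    · simp only [h1, if_true]
      split_ifs <;> positivity
    by_cases h2 : r = s
    · subst h2
      simp
    by_cases h3 : s = q
    · subst h3
      simp
    simp only [h1, h2, h3, if_false]
    have e1 := Real.exp_pos (-(common r s : ℝ))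
    have e2 := Real.exp_pos (-(common s q : ℝ))
    rcases min_le_iff.1 (min_common_le (s := s) h1) with h | h
    · have : Real.exp (-(common r q : ℝ)) ≤ Real.exp (-(common r s : ℝ)) :=
        Real.exp_le_exp.2 (neg_le_neg (by exact_mod_cast h))
      linarith
    · have : Real.exp (-(common r q : ℝ)) ≤ Real.exp (-(common s q : ℝ)) :=
        Real.exp_le_exp.2 (neg_le_neg (by exact_mod_cast h))
      linarith
  eq_of_dist_eq_zero {r s} h := by
    by_contra hne
    simp only [hne, if_false] at h
    exact (Real.exp_pos _).ne' h

end Ray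

/-- The semigroup `M(X)_r = M(X)_Φ` with `Φ = {[ρ_r] : r a geodesic ray starting at x₀}`. -/
def raySemigroup {X : Type*} [MetricSpace X] [Nonempty X] (x₀ : X) :
    Subsemigroup (MetricClass X) :=
  restrictedSubsemigroup MetricClass.mul_star_mul (Set.range (Ray.idem (x₀ := x₀)))
    (by rintro _ ⟨r, rfl⟩; exact MetricClass.star_ofSet _ _)

/-! ### Partial bijective locally bi-Lipschitz maps -/

section PBLBL

variable {Y : Type*} [MetricSpace Y]

/-- Countable unions of closed sets. -/
def IsFSigma (A : Set Y) : Prop := ∃ F : ℕ → Set Y, (∀ n, IsClosed (F n)) ∧ A = ⋃ n, F n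

/-- The domain of a partial bijection. -/
def pdom (f : Y ≃. Y) : Set Y := {x | (f x).isSome}

/-- A partial bijection `f` is locally Lipschitz if its domain is a countable union of compact sets
on each of which `f` is Lipschitz (with constants that may depend on the set). -/
def IsLocLipschitz (f : Y ≃. Y) : Prop :=
  ∃ K : ℕ → Set Y, (∀ n, IsCompact (K n)) ∧ pdom f = ⋃ n, K n ∧
    ∀ n, ∃ C : ℝ, ∀ x ∈ K n, ∀ x' ∈ K n, ∀ y ∈ f x, ∀ y' ∈ f x', dist y y' ≤ C * dist x x'

lemma IsLocLipschitz.isFSigma {f : Y ≃. Y} (h : IsLocLipschitz f) : IsFSigma (pdom f) := by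
  obtain ⟨K, hK, hU, -⟩ := h
  exact ⟨K, fun n => (hK n).isClosed, hU⟩

lemma IsLocLipschitz.trans {f g : Y ≃. Y} (hf : IsLocLipschitz f) (hg : IsLocLipschitz g) :
    IsLocLipschitz (f.trans g) := by
  obtain ⟨K, hK, hKU, hKL⟩ := hf
  obtain ⟨L, hL, hLU, hLL⟩ := hg
  have hdom : ∀ n, ∀ x ∈ K n, ∃ y, y ∈ f x := by
    intro n x hx
    have : x ∈ pdom f := by
      rw [hKU]
      exact Set.mem_iUnion.2 ⟨n, hx⟩
    exact Option.isSome_iff_exists.1 this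
  have hcl : ∀ n m, IsCompact (K n ∩ (fun x => (f x).getD x) ⁻¹' L m) := by
    intro n m
    obtain ⟨C, hC⟩ := hKL n
    have hlip : LipschitzOnWith (C.toNNReal) (fun x => (f x).getD x) (K n) := by
      refine LipschitzOnWith.of_dist_le_mul fun x hx x' hx' => ?_
      obtain ⟨y, hy⟩ := hdom n x hx
      obtain ⟨y', hy'⟩ := hdom n x' hx'
      have h := hC x hx x' hx' y hy y' hy'
      simp only [Option.mem_def] at hy hy'
      simp only [hy, hy', Option.getD_some]
      exact h.trans (mul_le_mul_of_nonneg_right (Real.le_coe_toNNReal C) dist_nonneg)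
    exact (hK n).of_isClosed_subset
      (hlip.continuousOn.preimage_isClosed_of_isClosed (hK n).isClosed (hL m).isClosed)
      Set.inter_subset_left
  refine ⟨fun k => K k.unpair.1 ∩ (fun x => (f x).getD x) ⁻¹' L k.unpair.2,
    fun k => hcl _ _, ?_, ?_⟩
  · ext x
    simp only [Set.mem_iUnion]
    constructor
    · intro hx
      obtain ⟨z, hz⟩ := Option.isSome_iff_exists.1 hx
      obtain ⟨y, hy, hyz⟩ := (PEquiv.mem_trans f g x z).1 hz
      have h1 : x ∈ pdom f := Option.isSome_iff_exists.2 ⟨y, hy⟩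
      have h2 : y ∈ pdom g := Option.isSome_iff_exists.2 ⟨z, hyz⟩
      rw [hKU] at h1
      rw [hLU] at h2
      obtain ⟨n, hn⟩ := Set.mem_iUnion.1 h1
      obtain ⟨m, hm⟩ := Set.mem_iUnion.1 h2
      refine ⟨Nat.pair n m, ?_⟩
      simp only [Option.mem_def] at hy
      simp only [Nat.unpair_pair, Set.mem_inter_iff, Set.mem_preimage, hy, Option.getD_some]
      exact ⟨hn, hm⟩
    · rintro ⟨k, hk, hk'⟩
      obtain ⟨y, hy⟩ := hdom _ x hk
      have hy2 : f x = some y := hy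
      simp only [Set.mem_preimage, hy2, Option.getD_some] at hk'
      have h2 : y ∈ pdom g := by
        rw [hLU]
        exact Set.mem_iUnion.2 ⟨_, hk'⟩
      obtain ⟨z, hz⟩ := Option.isSome_iff_exists.1 h2
      exact Option.isSome_iff_exists.2 ⟨z, (PEquiv.mem_trans f g x z).2 ⟨y, hy, hz⟩⟩
  · intro k
    obtain ⟨C, hC⟩ := hKL k.unpair.1
    obtain ⟨D, hD⟩ := hLL k.unpair.2
    refine ⟨max D 0 * C, ?_⟩
    rintro x ⟨hx, hxL⟩ x' ⟨hx', hxL'⟩ z hz z' hz'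
    obtain ⟨y, hy, hyz⟩ := (PEquiv.mem_trans f g x z).1 hz
    obtain ⟨y', hy', hyz'⟩ := (PEquiv.mem_trans f g x' z').1 hz'
    have hy2 : f x = some y := hy
    have hy2' : f x' = some y' := hy'
    simp only [Set.mem_preimage, hy2, Option.getD_some] at hxL
    simp only [Set.mem_preimage, hy2', Option.getD_some] at hxL'
    calc dist z z' ≤ D * dist y y' := hD y hxL y' hxL' z hyz z' hyz'
      _ ≤ max D 0 * dist y y' := mul_le_mul_of_nonneg_right (le_max_left _ _) dist_nonneg
      _ ≤ max D 0 * (C * dist x x') :=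
        mul_le_mul_of_nonneg_left (hC x hx x' hx' y hy y' hy') (le_max_right _ _)
      _ = max D 0 * C * dist x x' := by ring

/-- `PBLBL(Y)`: locally bi-Lipschitz bijections between two `F_σ` subsets of `Y`. -/
@[ext]
structure PBLBL (Y : Type*) [MetricSpace Y] where
  toPEquiv : Y ≃. Y
  fsigma_dom : IsFSigma (pdom toPEquiv)
  fsigma_range : IsFSigma (pdom toPEquiv.symm)
  locLipschitz : IsLocLipschitz toPEquiv
  locLipschitz_symm : IsLocLipschitz toPEquiv.symm

/-- The product `f g` is the composition `f ∘ g` of partial bijections: first `g`, then `f`. -/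
instance : Semigroup (PBLBL Y) where
  mul f g :=
    { toPEquiv := g.toPEquiv.trans f.toPEquiv
      fsigma_dom := (g.locLipschitz.trans f.locLipschitz).isFSigma
      fsigma_range := by
        rw [PEquiv.symm_trans_rev]
        exact (f.locLipschitz_symm.trans g.locLipschitz_symm).isFSigma
      locLipschitz := g.locLipschitz.trans f.locLipschitz
      locLipschitz_symm := by
        rw [PEquiv.symm_trans_rev]
        exact f.locLipschitz_symm.trans g.locLipschitz_symm }
  mul_assoc f g h := PBLBL.ext (PEquiv.trans_assoc _ _ _).symm

end PBLBL

/-! ### The metric realization of a rooted tree -/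

section Tree

/-- The level of a vertex: its distance to the root `⊥`. -/
def treeLevel {T : RootedTree} (v : T) : ℕ :=
  sInf {n | Order.pred^[n] v = ⊥}

/-- The points of the metric realization of a rooted tree, with edges of length one. Every point
other than the root lies on a unique half-open edge `(pred v, v]`; it is given by the vertex
`v = top` and by its distance `drop ∈ [0, 1)` from `v`. The root is `top = ⊥`, `drop = 0`. -/
@[ext]
structure TreeSpace (T : RootedTree) where
  top : T
  drop : ℝ
  drop_nonneg : 0 ≤ drop
  drop_lt_one : drop < 1
  drop_root : top = ⊥ → drop = 0

variable {T : RootedTree}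

lemma treeLevel_spec (v : T) : Order.pred^[treeLevel v] v = ⊥ :=
  Nat.sInf_mem (s := {n | Order.pred^[n] v = ⊥}) (bot_le (a := v)).exists_pred_iterate

lemma treeLevel_eq_zero {v : T} (h : treeLevel v = 0) : v = ⊥ := by
  have := treeLevel_spec v
  rwa [h] at this

lemma treeLevel_strictMono : StrictMono (treeLevel (T := T)) := by
  intro v w hvw
  obtain ⟨n, hn⟩ := hvw.le.exists_pred_iterate
  by_contra! hle
  have hw := treeLevel_spec w
  rcases le_total n (treeLevel w) with h | h
  · obtain ⟨k, hk⟩ := Nat.exists_eq_add_of_le h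
    rw [hk, add_comm, Function.iterate_add_apply, hn] at hw
    have h2 : treeLevel v ≤ k := Nat.sInf_le hw
    have h3 : n = 0 := by omega
    subst h3
    exact hvw.ne hn.symm
  · obtain ⟨k, rfl⟩ := Nat.exists_eq_add_of_le h
    rw [add_comm, Function.iterate_add_apply, hw] at hn
    have hb : Order.pred^[k] (⊥ : T) = ⊥ := by
      apply Function.iterate_fixed
      simp
    rw [hb] at hn
    have h2 : treeLevel v ≤ 0 := Nat.sInf_le (show Order.pred^[0] v = ⊥ from hn.symm)
    have h3 : w = ⊥ := treeLevel_eq_zero (by omega)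
    rw [h3] at hvw
    exact not_lt_bot hvw

lemma min_treeLevel_inf (u v w : T) :
    min (treeLevel (u ⊓ v)) (treeLevel (v ⊓ w)) ≤ treeLevel (u ⊓ w) := by
  rcases le_total_of_directed (inf_le_left : v ⊓ w ≤ v) (inf_le_right : u ⊓ v ≤ v) with h | h
  · exact (min_le_left _ _).trans (treeLevel_strictMono.monotone
      (le_inf inf_le_left (h.trans inf_le_right)))
  · exact (min_le_right _ _).trans (treeLevel_strictMono.monotone
      (le_inf (h.trans inf_le_left) inf_le_right))

namespace TreeSpace

/-- The distance of a point to the root. -/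
def height (p : TreeSpace T) : ℝ := treeLevel p.top - p.drop

/-- The length of the common part of the segments from the root to `p` and to `q`. -/
def meet (p q : TreeSpace T) : ℝ := min (min p.height q.height) (treeLevel (p.top ⊓ q.top))

lemma meet_comm (p q : TreeSpace T) : meet p q = meet q p := by
  unfold meet
  rw [min_comm p.height q.height, inf_comm p.top]

lemma min_meet_le (p q r : TreeSpace T) : min (meet p q) (meet q r) ≤ meet p r := by
  have h := min_treeLevel_inf p.top q.top r.top
  have h' : min (treeLevel (p.top ⊓ q.top) : ℝ) (treeLevel (q.top ⊓ r.top)) ≤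
      treeLevel (p.top ⊓ r.top) := by exact_mod_cast h
  unfold meet
  refine le_min (le_min ?_ ?_) ?_
  · exact (min_le_left _ _).trans ((min_le_left _ _).trans (min_le_left _ _))
  · exact (min_le_right _ _).trans ((min_le_left _ _).trans (min_le_right _ _))
  · exact le_trans (le_min ((min_le_left _ _).trans (min_le_right _ _))
      ((min_le_right _ _).trans (min_le_right _ _))) h'

lemma meet_le_left (p q : TreeSpace T) : meet p q ≤ p.height :=
  (min_le_left _ _).trans (min_le_left _ _)

lemma meet_le_right (p q : TreeSpace T) : meet p q ≤ q.height :=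
  (min_le_left _ _).trans (min_le_right _ _)

lemma top_eq_of_le {p q : TreeSpace T} (h : p.height ≤ treeLevel (p.top ⊓ q.top)) :
    p.top ⊓ q.top = p.top := by
  by_contra hne
  have hlt := treeLevel_strictMono (lt_of_le_of_ne inf_le_left hne)
  have hlt' : (treeLevel (p.top ⊓ q.top) : ℝ) + 1 ≤ treeLevel p.top := by exact_mod_cast hlt
  have := p.drop_lt_one
  unfold height at h
  linarith

/-- The intrinsic metric: the segment from `p` to `q` descends from `p` to the branching point of
the segments from the root to `p` and `q`, and then ascends to `q`. -/
instance : MetricSpace (TreeSpace T) where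
  dist p q := p.height + q.height - 2 * meet p q
  dist_self p := by
    have : meet p p = p.height := by
      unfold meet
      rw [min_self, inf_idem, min_eq_left]
      have := p.drop_nonneg
      unfold height
      linarith
    rw [this]
    ring
  dist_comm p q := by
    rw [meet_comm]
    ring
  dist_triangle p q r := by
    have h1 := meet_le_right p q
    have h2 := meet_le_left q r
    rcases min_le_iff.1 (min_meet_le p q r) with h | h <;> linarith
  eq_of_dist_eq_zero {p q} h := by
    have h1 := meet_le_left p q
    have h2 := meet_le_right p q
    have h3 : meet p q ≤ treeLevel (p.top ⊓ q.top) := min_le_right _ _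
    have e1 : p.height = meet p q := by linarith
    have e2 : q.height = meet p q := by linarith
    have t1 := top_eq_of_le (p := p) (q := q) (by linarith)
    have t2 := top_eq_of_le (p := q) (q := p) (by rw [inf_comm]; linarith)
    have t : p.top = q.top := by rw [← t1, inf_comm, t2]
    have e : p.height = q.height := by linarith
    unfold height at e
    rw [t] at e
    exact TreeSpace.ext t (by linarith)

/-- The root, as the basepoint `x₀`. -/
def root (T : RootedTree) : TreeSpace T := ⟨⊥, 0, le_rfl, one_pos, fun _ => rfl⟩

instance : Nonempty (TreeSpace T) := ⟨root T⟩

end TreeSpace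

end Tree

end

/-! Everything reduces to one geometric relation. For a representative ρ of `s`, the three equations
`Related s r t` hold exactly when ρ(r(u), t(u)') stays bounded in u, which is `Matched ρ r t`
(`related_mk`). This works because coarse equivalence of compatible metrics only says that each is
bounded where the other is (`mk_eq_iff`). In a tree, rays at bounded distance coincide, so the
relation is a partial bijection of ∂X.

For the homomorphism property, matchings compose for arbitrary classes. The converse uses membership
in `halfRestricted`: a ray on which the product does not vanish must have a partner under the first
factor, and that partner must have one under the second (`related_mul_iff`).

The partial map is locally Lipschitz because the rays matched with constant at most n form a compact
set, by local finiteness, and on it branching points move towards the root by at most n. As d =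
e^{-|γ|}, this means Lipschitz with constant e^n (`isLocLipschitz_partialMap`).

For surjectivity, given a locally bi-Lipschitz f, glue r(u) to (f(r)(u))' at a cost depending on r
and f(r) only (`exists_metric`). The cost must bound the distortion between any two glued pairs, so
that the triangle inequalities hold. It must also be small only on closed subsets of the domain, so
that a ray outside the domain leaves every sublevel set and its idempotent is sent to zero. The
weights of `exists_weight` achieve both. -/

/-! ### Coarse equivalence tested on bounded sets. -/

namespace DoubleMetric

variable {X : Type*} [MetricSpace X]

/-- A locally bounded function of `t ≥ 0` has a continuous monotone majorant. -/
lemma exists_continuous_monotone_majorant (F : ℕ → ℝ≥0) :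
    ∃ G : ℝ≥0 → ℝ≥0, Continuous G ∧ Monotone G ∧ ∀ (t : ℝ≥0) (n : ℕ), (n : ℝ≥0) ≤ t + 1 →
      F n ≤ G t := by
  -- With truncated subtraction the ramp `min 1 (t + 2 - n)` vanishes for t ≤ n - 2 and equals 1 for
  -- t ≥ n - 1, so near any t only finitely many summands survive.
  have hlf : LocallyFinite fun n : ℕ => Function.support fun t : ℝ≥0 => F n * min 1 (t + 2 - n) := by
    intro t
    refine ⟨Set.Iio (t + 1), Iio_mem_nhds (by simp), (Set.finite_Iio (⌈t⌉₊ + 3)).subset ?_⟩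
    rintro n ⟨x, hx, hxt⟩
    simp only [Function.mem_support, ne_eq, mul_eq_zero, not_or] at hx
    simp only [Set.mem_Iio] at hxt ⊢
    by_contra! hn
    apply hx.2
    have h1 : t ≤ ⌈t⌉₊ := Nat.le_ceil t
    have h2 : ((⌈t⌉₊ + 3 : ℕ) : ℝ≥0) ≤ n := by exact_mod_cast hn
    push_cast at h2
    have h3 : x + 2 ≤ n := by
      calc x + 2 ≤ t + 1 + 2 := by gcongr
        _ = t + 3 := by ring
        _ ≤ _ := (by gcongr : t + 3 ≤ ⌈t⌉₊ + 3).trans h2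
    rw [tsub_eq_zero_of_le h3]
    simp
  have hfin : ∀ t : ℝ≥0, (Function.support fun n : ℕ => F n * min 1 (t + 2 - n)).Finite :=
    fun t => hlf.point_finite t
  refine ⟨fun t => ∑ᶠ n : ℕ, F n * min 1 (t + 2 - n), continuous_finsum (fun n => ?_) hlf, ?_, ?_⟩
  · fun_prop
  · intro a b hab
    refine finsum_le_finsum' (hfin a) (hfin b) fun n => ?_
    gcongr
  · intro t n hn
    have h1 : F n * min 1 (t + 2 - n) = F n := by
      rw [min_eq_left, mul_one]
      refine le_tsub_of_add_le_right ?_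
      calc 1 + (n : ℝ≥0) ≤ 1 + (t + 1) := by gcongr
        _ = t + 2 := by ring
    calc F n = F n * min 1 (t + 2 - n) := h1.symm
      _ ≤ _ := single_le_finsum n (hfin t) fun _ => zero_le

/-- `ρ` is bounded on the sets on which `σ` is bounded. -/
def Dominated (ρ σ : DoubleMetric X) : Prop :=
  ∀ C : ℝ, ∃ D : ℝ, ∀ x y, σ.cross x y ≤ C → ρ.cross x y ≤ D

/-- The bounds on integer sublevel sets have a continuous monotone majorant G, but φ must also be
strictly increasing and fix 0. The function t + K·t·G(t) does both. It still dominates G at all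
cross distances, since these are bounded below by the gaps and K is chosen to make K·t ≥ 1 there. -/
lemma coarseEquiv_of_dominated {ρ σ : DoubleMetric X} (h1 : Dominated ρ σ) (h2 : Dominated σ ρ) :
    CoarseEquiv ρ σ := by
  choose D hD using h1
  choose E hE using h2
  obtain ⟨G, hGc, hGm, hG⟩ := exists_continuous_monotone_majorant
    fun n => (D n).toNNReal + (E n).toNNReal
  obtain ⟨c, hc, hρ⟩ := ρ.gap_cross
  obtain ⟨c', hc', hσ⟩ := σ.gap_cross
  set K : ℝ≥0 := (1 / min c c').toNNReal with hK
  have hK' : (K : ℝ) = 1 / min c c' := Real.coe_toNNReal _ (by positivity)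
  have hbig : ∀ t : ℝ, min c c' ≤ t → ∀ d : ℝ, d ≤ G t.toNNReal →
      d ≤ ((t.toNNReal + K * t.toNNReal * G t.toNNReal : ℝ≥0) : ℝ) := by
    intro t ht d hd
    have hm : 0 < min c c' := lt_min hc hc'
    have ht' : ((t.toNNReal : ℝ≥0) : ℝ) = t := Real.coe_toNNReal _ (by linarith)
    have h1 : 1 ≤ (K : ℝ) * t := by
      rw [hK', one_div, ← div_eq_inv_mul, one_le_div hm]
      exact ht
    push_cast
    rw [ht']
    have h2 : (0 : ℝ) ≤ G t.toNNReal := NNReal.coe_nonneg _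
    nlinarith
  have hle : ∀ t : ℝ, 0 ≤ t → t ≤ (⌈t⌉₊ : ℝ) ∧ (⌈t⌉₊ : ℝ≥0) ≤ t.toNNReal + 1 := by
    intro t ht
    refine ⟨Nat.le_ceil t, ?_⟩
    rw [← NNReal.coe_le_coe]
    push_cast
    rw [Real.coe_toNNReal _ ht]
    exact (Nat.ceil_lt_add_one ht).le
  refine coarseEquiv_of_cross ρ σ (fun t => t + K * t * G t) (by fun_prop) ?_ (by simp) ?_ ?_ ?_
  · intro a b hab
    refine add_lt_add_of_lt_of_le hab ?_
    have := hGm hab.le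
    gcongr
  · intro t
    exact le_self_add
  · intro x y
    obtain ⟨h3, h4⟩ := hle _ (σ.cross_nonneg x y)
    refine hbig _ ((min_le_right _ _).trans (hσ x y)) _ ?_
    refine (hD _ x y h3).trans ((Real.le_coe_toNNReal _).trans ?_)
    exact_mod_cast le_self_add.trans (hG _ _ h4)
  · intro x y
    obtain ⟨h3, h4⟩ := hle _ (ρ.cross_nonneg x y)
    refine hbig _ ((min_le_left _ _).trans (hρ x y)) _ ?_
    refine (hE _ x y h3).trans ((Real.le_coe_toNNReal _).trans ?_)
    exact_mod_cast le_add_self.trans (hG _ _ h4)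

lemma dominated_of_le {ρ σ : DoubleMetric X} (f : ℝ → ℝ) (hf : Monotone f)
    (h : ∀ x y, ρ.cross x y ≤ f (σ.cross x y)) : Dominated ρ σ :=
  fun C => ⟨f C, fun x y hxy => (h x y).trans (hf hxy)⟩

lemma CoarseEquiv.dominated {ρ σ : DoubleMetric X} (h : CoarseEquiv ρ σ) : Dominated ρ σ := by
  obtain ⟨φ, h⟩ := h
  exact fun C => ⟨φ C.toNNReal, fun x y hxy =>
    CoarseEquiv.cross_le (fun p q => (h p q).1) x y (hxy.trans (Real.le_coe_toNNReal C))⟩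

lemma exists_comp_cross_lt {ρ σ : DoubleMetric X} {x y : X} {C : ℝ}
    (h : (comp ρ σ).cross x y < C) : ∃ u, σ.cross x u + 1 + ρ.cross u y < C := by
  by_contra! hcon
  exact absurd (le_comp_cross ρ σ x y C hcon) (not_le.2 h)

lemma ofSet_cross_le {A : Set X} (hA : A.Nonempty) {a : X} (ha : a ∈ A) (x y : X) :
    (ofSet A hA).cross x y ≤ dist x a + 1 + dist a y :=
  ciInf_le (f := fun a : A => dist x (a : X) + 1 + dist (a : X) y)
    ⟨0, by rintro _ ⟨u, rfl⟩; positivity⟩ ⟨a, ha⟩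

lemma exists_ofSet_cross_lt {A : Set X} {hA : A.Nonempty} {x y : X} {C : ℝ}
    (h : (ofSet A hA).cross x y < C) : ∃ a ∈ A, dist x a + 1 + dist a y < C := by
  have : Nonempty A := hA.to_subtype
  obtain ⟨a, ha⟩ := exists_lt_of_ciInf_lt h
  exact ⟨a, a.2, ha⟩

lemma cross_le_add (ρ : DoubleMetric X) (x y a b : X) :
    ρ.cross x y ≤ dist x a + ρ.cross a b + dist b y := by
  have h1 := ρ.cross_le_left x a y
  have h2 := ρ.cross_le_right a y b
  linarith

end DoubleMetric

namespace MetricClass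

variable {X : Type*} [MetricSpace X]

lemma mk_eq_iff {ρ σ : DoubleMetric X} :
    mk ρ = mk σ ↔ DoubleMetric.Dominated ρ σ ∧ DoubleMetric.Dominated σ ρ :=
  ⟨fun h => ⟨(Quotient.exact h : ρ ≈ σ).dominated, (Quotient.exact h.symm : σ ≈ ρ).dominated⟩,
    fun h => mk_eq (DoubleMetric.coarseEquiv_of_dominated h.1 h.2)⟩

end MetricClass

/-! ### Matched rays and the equations for their idempotents. -/

namespace Ray

variable {X : Type*} [MetricSpace X] {x₀ : X}

lemma dist_apply (r : Ray x₀) (u v : ℝ≥0) : dist (r.1 u) (r.1 v) = |(u : ℝ) - v| := by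
  rw [r.2.1.dist_eq, NNReal.dist_eq]

lemma dist_root (r : Ray x₀) (u : ℝ≥0) : dist x₀ (r.1 u) = u := by
  have h := r.dist_apply 0 u
  rw [r.2.2] at h
  simpa using h

/-- The distance `ρ` from `r u` to `(t u)'` is bounded. -/
def Matched (ρ : DoubleMetric X) (r t : Ray x₀) : Prop :=
  ∃ C : ℝ, ∀ u, ρ.cross (r.1 u) (t.1 u) ≤ C

lemma Matched.adjoint {ρ : DoubleMetric X} {r t : Ray x₀} (h : Matched ρ r t) :
    Matched ρ.adjoint t r := h

lemma Matched.comp {ρ σ : DoubleMetric X} {r q t : Ray x₀} (h : Matched σ r q)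
    (h' : Matched ρ q t) : Matched (DoubleMetric.comp ρ σ) r t := by
  obtain ⟨C, hC⟩ := h
  obtain ⟨D, hD⟩ := h'
  refine ⟨C + 1 + D, fun u => (DoubleMetric.comp_cross_le ρ σ _ _ (q.1 u)).trans ?_⟩
  have := hC u
  have := hD u
  linarith

/-- The relation between rays given by the class `s`. -/
def Related (s : MetricClass X) (r t : Ray x₀) : Prop :=
  r.idem * star s * s = r.idem ∧ s * r.idem = t.idem * s ∧ t.idem * s * star s = t.idem

/-- The projection `[ρ]* [ρ]` dominates `e_r` when `ρ` matches `r` to a ray. -/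
lemma Matched.idem_mul_star_mul {ρ : DoubleMetric X} {r t : Ray x₀} (h : Matched ρ r t) :
    r.idem * star (MetricClass.mk ρ) * MetricClass.mk ρ = r.idem := by
  obtain ⟨C, hC⟩ := h
  refine MetricClass.mk_eq_iff.2 ⟨?_, ?_⟩
  · refine DoubleMetric.dominated_of_le (fun c => c + 2 + 2 * C) (fun a b hab => by simpa) ?_
    intro x y
    rw [← sub_le_iff_le_add, ← sub_le_iff_le_add]
    refine le_of_forall_gt fun c hc => ?_
    obtain ⟨a, ⟨u, rfl⟩, ha⟩ := DoubleMetric.exists_ofSet_cross_lt hc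
    -- Go from x to (t u)', back to r u, then on to y. Compared with the direct route through r u,
    -- this costs 2C + 2 more.
    have h1 := DoubleMetric.comp_cross_le (DoubleMetric.comp (DoubleMetric.ofSet r.image
      (Set.range_nonempty _)) ρ.adjoint) ρ x y (t.1 u)
    have h2 := DoubleMetric.comp_cross_le (DoubleMetric.ofSet r.image
      (Set.range_nonempty _)) ρ.adjoint (t.1 u) y (r.1 u)
    have h3 := DoubleMetric.ofSet_cross_le (A := r.image) (Set.range_nonempty _) ⟨u, rfl⟩ (r.1 u) y
    rw [DoubleMetric.adjoint_cross] at h2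
    rw [dist_self] at h3
    have h4 := ρ.cross_le_left x (r.1 u) (t.1 u)
    have h5 := hC u
    rw [sub_lt_iff_lt_add, sub_lt_iff_lt_add]
    linarith
  -- This half holds for every ρ: going over to z' and back to w costs at least d(x, w).
  · refine DoubleMetric.dominated_of_le id monotone_id ?_
    intro x y
    refine DoubleMetric.le_comp_cross _ _ _ _ _ fun z => ?_
    rw [← sub_le_iff_le_add']
    refine DoubleMetric.le_comp_cross _ _ _ _ _ fun w => ?_
    rw [DoubleMetric.adjoint_cross]
    have h1 := ρ.dist_le_left x w z
    have h2 := (DoubleMetric.ofSet r.image (Set.range_nonempty _)).cross_le_left x w y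
    linarith

end Ray

namespace Ray

variable {X : Type*} [MetricSpace X] {x₀ : X}

/-- Either composite is small only along a path passing near r(u) or near t(u)'. As these two points
are within C of each other, x is then near r(u) and y' near t(u)' for the same u, and the path can
be rerouted through the other ray. -/
lemma Matched.mul_idem {ρ : DoubleMetric X} {r t : Ray x₀} (h : Matched ρ r t) :
    MetricClass.mk ρ * r.idem = t.idem * MetricClass.mk ρ := by
  obtain ⟨C, hC⟩ := h
  refine MetricClass.mk_eq_iff.2 ⟨fun B => ⟨2 * (B + 1) + 2 * C + 2, fun x y hxy => ?_⟩,
    fun B => ⟨2 * (B + 1) + 2 * C + 2, fun x y hxy => ?_⟩⟩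
  · obtain ⟨z, hz⟩ := DoubleMetric.exists_comp_cross_lt (lt_of_le_of_lt hxy (lt_add_one B))
    have hz' : (DoubleMetric.ofSet t.image (Set.range_nonempty _)).cross z y < B - ρ.cross x z := by
      linarith
    obtain ⟨_, ⟨u, rfl⟩, hb⟩ := DoubleMetric.exists_ofSet_cross_lt hz'
    have h1 := DoubleMetric.comp_cross_le ρ (DoubleMetric.ofSet r.image
      (Set.range_nonempty _)) x y (r.1 u)
    have h2 := DoubleMetric.ofSet_cross_le (A := r.image) (Set.range_nonempty _) ⟨u, rfl⟩ x (r.1 u)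
    rw [dist_self] at h2
    have h3 := hC u
    have h4 := ρ.dist_le_left x (r.1 u) (t.1 u)
    have h5 := ρ.cross_le_right x (t.1 u) z
    have h6 := ρ.cross_le_right (r.1 u) y (t.1 u)
    have h7 := ρ.cross_nonneg x z
    have h8 : 0 ≤ dist z (t.1 u) := dist_nonneg
    have h9 : 0 ≤ dist (t.1 u) y := dist_nonneg
    linarith
  · obtain ⟨z, hz⟩ := DoubleMetric.exists_comp_cross_lt (lt_of_le_of_lt hxy (lt_add_one B))
    have hz' : (DoubleMetric.ofSet r.image (Set.range_nonempty _)).cross x z < B - ρ.cross z y := by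
      linarith
    obtain ⟨_, ⟨u, rfl⟩, hb⟩ := DoubleMetric.exists_ofSet_cross_lt hz'
    have h1 := DoubleMetric.comp_cross_le (DoubleMetric.ofSet t.image
      (Set.range_nonempty _)) ρ x y (t.1 u)
    have h2 := DoubleMetric.ofSet_cross_le (A := t.image) (Set.range_nonempty _) ⟨u, rfl⟩ (t.1 u) y
    rw [dist_self] at h2
    have h3 := hC u
    have h4 := ρ.dist_le_right (r.1 u) (t.1 u) y
    have h5 := ρ.cross_le_left (r.1 u) z y
    have h6 := ρ.cross_le_left x (r.1 u) (t.1 u)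
    have h7 := ρ.cross_nonneg z y
    have h8 : 0 ≤ dist x (r.1 u) := dist_nonneg
    have h9 : 0 ≤ dist (r.1 u) z := dist_nonneg
    linarith

lemma Matched.related {ρ : DoubleMetric X} {r t : Ray x₀} (h : Matched ρ r t) :
    Related (MetricClass.mk ρ) r t := by
  refine ⟨h.idem_mul_star_mul, h.mul_idem, ?_⟩
  have h' := h.adjoint.idem_mul_star_mul
  exact h'

/-- Both rays have unit speed, so comparing with the fixed pair (0, v₀) gives |v - u| ≤ v₀ + 2C.
Replacing v by u therefore costs a bounded amount. -/
lemma matched_of_forall_exists {ρ : DoubleMetric X} {r t : Ray x₀} {C : ℝ}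
    (h : ∀ u, ∃ v, ρ.cross (r.1 u) (t.1 v) ≤ C) : Matched ρ r t := by
  obtain ⟨v₀, h₀⟩ := h 0
  refine ⟨C + (v₀ + 2 * C), fun u => ?_⟩
  obtain ⟨v, hv⟩ := h u
  have h1 := ρ.dist_le_right (r.1 u) (t.1 v) (t.1 v₀)
  have h2 := ρ.cross_le_left (r.1 u) (r.1 0) (t.1 v₀)
  have h3 := ρ.dist_le_left (r.1 0) (r.1 u) (t.1 v)
  have h4 := ρ.cross_le_right (r.1 0) (t.1 v) (t.1 v₀)
  have h5 := ρ.cross_le_right (r.1 u) (t.1 u) (t.1 v)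
  simp only [dist_apply, NNReal.coe_zero, sub_zero, zero_sub, abs_neg, NNReal.abs_eq] at h1 h2 h3 h4 h5
  have h6 : |(v : ℝ) - u| ≤ v₀ + 2 * C := by
    have hv0 := v.2
    have hu0 := u.2
    have hw0 := v₀.2
    have hs := abs_sub_comm (v₀ : ℝ) v
    rw [abs_le]
    constructor
    · rcases abs_cases ((v : ℝ) - v₀) with ⟨e, -⟩ | ⟨e, -⟩ <;> simp only [NNReal.val_eq_coe] at * <;> linarith
    · have := le_abs_self ((v : ℝ) - v₀)
      linarith
  linarith

/-- The equation e_r s*s = e_r, evaluated at (r u, r u), provides a y with ρ(r u, y') bounded. Then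
s e_r is bounded at (r u, y'), hence so is e_t s, and this yields a point of t near y. The extra 2
in `C + 2` is the value 1 of e_r at (r u, r u) plus the 1 in the composition. -/
lemma Related.matched {ρ : DoubleMetric X} {r t : Ray x₀} (h : Related (MetricClass.mk ρ) r t) :
    Matched ρ r t := by
  obtain ⟨h1, h2, -⟩ := h
  obtain ⟨C, hC⟩ := (MetricClass.mk_eq_iff.1 h1).1 1
  obtain ⟨D, hD⟩ := (MetricClass.mk_eq_iff.1 h2).2 (C + 2)
  refine matched_of_forall_exists (C := 2 * (D + 1)) fun u => ?_
  have hu : (DoubleMetric.ofSet r.image (Set.range_nonempty _)).cross (r.1 u) (r.1 u) ≤ 1 := by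
    simpa using DoubleMetric.ofSet_cross_le (A := r.image) (Set.range_nonempty _) ⟨u, rfl⟩
      (r.1 u) (r.1 u)
  obtain ⟨y, hy⟩ := DoubleMetric.exists_comp_cross_lt
    (lt_of_le_of_lt (hC (r.1 u) (r.1 u) hu) (lt_add_one C))
  have hy0 := (DoubleMetric.comp (DoubleMetric.ofSet r.image
      (Set.range_nonempty _)) ρ.adjoint).cross_nonneg y (r.1 u)
  have h3 := DoubleMetric.comp_cross_le ρ (DoubleMetric.ofSet r.image
      (Set.range_nonempty _)) (r.1 u) y (r.1 u)
  have h4 : (DoubleMetric.comp ρ (DoubleMetric.ofSet r.image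
      (Set.range_nonempty _))).cross (r.1 u) y ≤ C + 2 := by linarith
  obtain ⟨z, hz⟩ := DoubleMetric.exists_comp_cross_lt
    (lt_of_le_of_lt (hD _ _ h4) (lt_add_one D))
  have hz' : (DoubleMetric.ofSet t.image (Set.range_nonempty _)).cross z y <
      D - ρ.cross (r.1 u) z := by linarith
  obtain ⟨_, ⟨v, rfl⟩, hb⟩ := DoubleMetric.exists_ofSet_cross_lt hz'
  refine ⟨v, ?_⟩
  have h5 := ρ.cross_le_right (r.1 u) (t.1 v) z
  have h7 := ρ.cross_nonneg (r.1 u) z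
  have h8 : 0 ≤ dist z (t.1 v) := dist_nonneg
  have h9 : 0 ≤ dist (t.1 v) y := dist_nonneg
  linarith

lemma related_mk {ρ : DoubleMetric X} {r t : Ray x₀} :
    Related (MetricClass.mk ρ) r t ↔ Matched ρ r t :=
  ⟨Related.matched, Matched.related⟩

lemma Related.star {s : MetricClass X} {r t : Ray x₀} (h : Related s r t) :
    Related (star s) t r := by
  induction s using Quotient.inductionOn with
  | h ρ => exact (Related.matched h).adjoint.related

lemma related_star_iff {s : MetricClass X} {r t : Ray x₀} :
    Related (star s) r t ↔ Related s t r :=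
  ⟨fun h => by simpa using h.star, Related.star⟩

lemma Related.mul {s s' : MetricClass X} {r q t : Ray x₀} (h : Related s' r q)
    (h' : Related s q t) : Related (s * s') r t := by
  induction s using Quotient.inductionOn with
  | h ρ =>
    induction s' using Quotient.inductionOn with
    | h σ => exact (h.matched.comp h'.matched).related

lemma idem_ne_zero [Nonempty X] (r : Ray x₀) : r.idem ≠ 0 := by
  intro h
  obtain ⟨D, hD⟩ := (MetricClass.mk_eq_iff.1 h).2 1
  set a : X := Classical.arbitrary X
  have key : ∀ u : ℝ≥0, (u : ℝ) ≤ D + dist x₀ a := by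
    intro u
    have hu : (DoubleMetric.ofSet r.image (Set.range_nonempty _)).cross (r.1 u) (r.1 u) ≤ 1 := by
      simpa using DoubleMetric.ofSet_cross_le (A := r.image) (Set.range_nonempty _) ⟨u, rfl⟩
        (r.1 u) (r.1 u)
    have h1 := hD _ _ hu
    rw [DoubleMetric.ofSet_singleton_cross] at h1
    have h2 := r.dist_root u
    have h3 := dist_triangle x₀ a (r.1 u)
    have h4 : 0 ≤ dist (r.1 u) a := dist_nonneg
    linarith
  have h1 := key ((D + dist x₀ a).toNNReal + 1)
  have h2 := Real.le_coe_toNNReal (D + dist x₀ a)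
  push_cast at h1
  linarith

/-- A path of bounded cost for e_r ρ*ρ passes near some r(u) with ρ(r u, z') bounded. By hypothesis
such u are bounded, so both endpoints lie within a bounded distance of the root, and hence of `a`.
-/
lemma idem_mul_star_mul_eq_zero [Nonempty X] {ρ : DoubleMetric X} {r : Ray x₀}
    (h : ∀ C : ℝ, ∃ M : ℝ, ∀ u y, ρ.cross (r.1 u) y ≤ C → (u : ℝ) ≤ M) :
    r.idem * star (MetricClass.mk ρ) * MetricClass.mk ρ = 0 := by
  set a : X := Classical.arbitrary X
  set τ := DoubleMetric.comp (DoubleMetric.comp (DoubleMetric.ofSet r.image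
    (Set.range_nonempty _)) ρ.adjoint) ρ with hτ
  refine MetricClass.mk_eq_iff.2 ⟨?_, fun C => ?_⟩
  -- Zero is the least class: any compatible metric is bounded by the route through a and a'.
  · refine DoubleMetric.dominated_of_le (fun c => c + τ.cross a a)
      (fun a b hab => by simpa) fun x y => ?_
    have h1 := τ.cross_le_add x y a a
    rw [DoubleMetric.ofSet_singleton_cross]
    linarith
  · obtain ⟨M, hM⟩ := h (2 * (C + 1))
    refine ⟨4 * (C + 1) + 2 * M + 2 * dist x₀ a + 1, fun x y hxy => ?_⟩
    rw [DoubleMetric.ofSet_singleton_cross]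
    obtain ⟨z, hz⟩ := DoubleMetric.exists_comp_cross_lt (lt_of_le_of_lt hxy (lt_add_one C))
    have hz' : (DoubleMetric.comp (DoubleMetric.ofSet r.image
      (Set.range_nonempty _)) ρ.adjoint).cross z y < C - ρ.cross x z := by linarith
    obtain ⟨w, hw⟩ := DoubleMetric.exists_comp_cross_lt hz'
    rw [DoubleMetric.adjoint_cross] at hw
    have hw' : (DoubleMetric.ofSet r.image (Set.range_nonempty _)).cross w y <
      C - 1 - ρ.cross x z - ρ.cross w z := by linarith
    obtain ⟨_, ⟨u, rfl⟩, hb⟩ := DoubleMetric.exists_ofSet_cross_lt hw'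
    have h1 := ρ.cross_le_left (r.1 u) w z
    have h2 := ρ.dist_le_left x (r.1 u) z
    have h3 := ρ.cross_nonneg x z
    have h4 := ρ.cross_nonneg w z
    have h5 := dist_comm w (r.1 u)
    have h6 : 0 ≤ dist w (r.1 u) := dist_nonneg
    have h7 : 0 ≤ dist (r.1 u) y := dist_nonneg
    have h8 := hM u z (by linarith)
    have h9 := r.dist_root u
    have h10 := dist_triangle4 x (r.1 u) x₀ a
    have h11 := dist_triangle4 a x₀ (r.1 u) y
    rw [dist_comm (r.1 u) x₀] at h10
    rw [dist_comm a x₀] at h11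
    linarith

end Ray

/-! ### Heights, levels and local finiteness of the tree. -/

namespace TreeSpace

variable {T : RootedTree}

lemma dist_def (p q : TreeSpace T) : dist p q = p.height + q.height - 2 * meet p q := rfl

lemma treeLevel_bot : treeLevel (⊥ : T) = 0 :=
  Nat.sInf_eq_zero.2 (Or.inl rfl)

lemma height_nonneg (p : TreeSpace T) : 0 ≤ p.height := by
  unfold height
  rcases Nat.eq_zero_or_pos (treeLevel p.top) with h | h
  · simp [h, p.drop_root (treeLevel_eq_zero h)]
  · have h1 : (1 : ℝ) ≤ treeLevel p.top := by exact_mod_cast h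
    linarith [p.drop_lt_one]

lemma height_root : (root T).height = 0 := by
  simp [height, root, treeLevel_bot]

lemma meet_nonneg (p q : TreeSpace T) : 0 ≤ meet p q :=
  le_min (le_min p.height_nonneg q.height_nonneg) (Nat.cast_nonneg _)

lemma dist_root (p : TreeSpace T) : dist (root T) p = p.height := by
  have h1 := meet_le_left (root T) p
  have h2 := meet_nonneg (root T) p
  rw [height_root] at h1
  rw [dist_def, height_root]
  linarith

lemma treeLevel_eq_ceil (p : TreeSpace T) : treeLevel p.top = ⌈p.height⌉₊ := by
  symm
  rcases Nat.eq_zero_or_pos (treeLevel p.top) with h | h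
  · rw [h, Nat.ceil_eq_zero, height, h]
    linarith [p.drop_nonneg, (Nat.cast_zero : ((0 : ℕ) : ℝ) = 0)]
  · rw [Nat.ceil_eq_iff h.ne', height, Nat.cast_pred h]
    constructor <;> linarith [p.drop_nonneg, p.drop_lt_one]

lemma treeLevel_pred {v : T} (h : v ≠ ⊥) : treeLevel v = treeLevel (Order.pred v) + 1 := by
  have hlt : Order.pred v < v := Order.pred_lt_of_not_isMin (by rwa [isMin_iff_eq_bot])
  refine le_antisymm (Nat.sInf_le ?_) (treeLevel_strictMono hlt)
  change Order.pred^[treeLevel (Order.pred v) + 1] v = ⊥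
  rw [Function.iterate_succ_apply]
  exact treeLevel_spec _

lemma finite_treeLevel_eq (hfin : ∀ v : T, {w : T | v ⋖ w}.Finite) (n : ℕ) :
    {v : T | treeLevel v = n}.Finite := by
  induction n with
  | zero => exact (Set.finite_singleton ⊥).subset fun v hv => treeLevel_eq_zero hv
  | succ n ih =>
    refine (ih.biUnion fun v _ => hfin v).subset fun w hw => ?_
    have hw' : treeLevel w = n + 1 := hw
    have hne : w ≠ ⊥ := by
      rintro rfl
      rw [treeLevel_bot] at hw'
      omega
    have h1 := treeLevel_pred hne
    exact Set.mem_biUnion (x := Order.pred w) (show treeLevel (Order.pred w) = n by omega)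
      (Order.pred_covBy_of_not_isMin (by rwa [isMin_iff_eq_bot]))

/-- A point is determined by its top vertex and its height, and the top vertex lies on level ⌈u⌉,
which is finite by induction from the root. -/
lemma finite_height_eq (hfin : ∀ v : T, {w : T | v ⋖ w}.Finite) (u : ℝ) :
    {p : TreeSpace T | p.height = u}.Finite := by
  refine Set.Finite.of_finite_image (f := fun p : TreeSpace T => p.top)
    ((finite_treeLevel_eq hfin ⌈u⌉₊).subset ?_) ?_
  · rintro _ ⟨p, hp, rfl⟩
    have hp' : p.height = u := hp
    change treeLevel p.top = _
    rw [treeLevel_eq_ceil, hp']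
  · intro p hp q hq hpq
    have hpq' : p.top = q.top := hpq
    have hp' : p.height = u := hp
    have hq' : q.height = u := hq
    refine TreeSpace.ext hpq' ?_
    unfold height at hp' hq'
    rw [hpq'] at hp'
    linarith

end TreeSpace

/-! ### Rays in a tree, the boundary metric and compactness. -/

namespace Ray

variable {T : RootedTree}

open TreeSpace

lemma height_apply (r : Ray (root T)) (u : ℝ≥0) : (r.1 u).height = u := by
  rw [← TreeSpace.dist_root, r.dist_root]

lemma meet_apply (r : Ray (root T)) (u v : ℝ≥0) : meet (r.1 u) (r.1 v) = min (u : ℝ) v := by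
  have h := r.dist_apply u v
  rw [TreeSpace.dist_def, height_apply, height_apply] at h
  rcases le_total (u : ℝ) v with h' | h'
  · rw [abs_of_nonpos (by linarith)] at h
    rw [min_eq_left h']
    linarith
  · rw [abs_of_nonneg (by linarith)] at h
    rw [min_eq_right h']
    linarith

lemma eq_of_le_meet {r s : Ray (root T)} {u : ℝ≥0} (h : (u : ℝ) ≤ meet (r.1 u) (s.1 u)) :
    r.1 u = s.1 u := by
  rw [← dist_le_zero, TreeSpace.dist_def, height_apply, height_apply]
  linarith

/-- The common point at `v` meets each of r(u) and s(u) in height u, so the ultrametric inequality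
`min_meet_le` gives r(u) and s(u) a meet of full height. -/
lemma agree_of_le {r s : Ray (root T)} {u v : ℝ≥0} (h : r.1 v = s.1 v) (huv : u ≤ v) :
    r.1 u = s.1 u := by
  have huv' : (u : ℝ) ≤ v := by exact_mod_cast huv
  have h1 := min_meet_le (r.1 u) (r.1 v) (s.1 u)
  nth_rewrite 2 [h] at h1
  rw [meet_apply, meet_apply, min_eq_left huv', min_eq_right huv', min_self] at h1
  exact eq_of_le_meet h1

/-- Here m is the height of the point where the segments from the root to r(u) and s(v) separate.
This tripod formula turns distance estimates into statements about agreement. -/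
lemma exists_agree (r s : Ray (root T)) (u v : ℝ≥0) :
    ∃ m : ℝ≥0, m ≤ u ∧ m ≤ v ∧ r.1 m = s.1 m ∧ dist (r.1 u) (s.1 v) = u + v - 2 * m := by
  obtain ⟨m, hm⟩ : ∃ m : ℝ≥0, (m : ℝ) = meet (r.1 u) (s.1 v) :=
    ⟨⟨_, meet_nonneg _ _⟩, rfl⟩
  have h1 : (m : ℝ) ≤ u := by
    rw [hm, ← r.height_apply u]
    exact meet_le_left _ _
  have h2 : (m : ℝ) ≤ v := by
    rw [hm, ← s.height_apply v]
    exact meet_le_right _ _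
  refine ⟨m, by exact_mod_cast h1, by exact_mod_cast h2, ?_, ?_⟩
  · have h3 := min_meet_le (r.1 m) (r.1 u) (s.1 v)
    have h4 := min_meet_le (r.1 m) (s.1 v) (s.1 m)
    rw [meet_apply, min_eq_left h1, ← hm, min_self] at h3
    rw [meet_apply, min_eq_right h2, min_eq_right h3] at h4
    exact eq_of_le_meet h4
  · rw [TreeSpace.dist_def, height_apply, height_apply, hm]

lemma dist_le_of_agree {r s : Ray (root T)} {c : ℝ≥0} (h : r.1 c = s.1 c) {u v : ℝ≥0}
    (hu : c ≤ u) (hv : c ≤ v) : dist (r.1 u) (s.1 v) ≤ u + v - 2 * c := by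
  have h1 := dist_triangle (r.1 u) (r.1 c) (s.1 v)
  rw [r.dist_apply, h, s.dist_apply, abs_of_nonneg (by simpa using hu), abs_of_nonpos (by simpa using hv)] at h1
  linarith

/-- The distance is 2(u - m) with m the branching height, so m ≥ u - n. For u ≤ n the truncated
subtraction reduces the claim to the root. -/
lemma sub_le_of_dist_le {r s : Ray (root T)} {u : ℝ≥0} {n : ℝ≥0}
    (h : dist (r.1 u) (s.1 u) ≤ 2 * n) : r.1 (u - n) = s.1 (u - n) := by
  obtain ⟨m, -, -, hm, hd⟩ := r.exists_agree s u u
  refine agree_of_le hm (tsub_le_iff_right.2 ?_)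
  rw [hd] at h
  rw [← NNReal.coe_le_coe]
  push_cast
  linarith

lemma agree_common (r s : Ray (root T)) : r.1 (common r s) = s.1 (common r s) := by
  by_cases h : r = s
  · rw [h]
  have hc : IsClosed {t : ℝ≥0 | r.1 t = s.1 t} :=
    isClosed_eq r.2.1.continuous s.2.1.continuous
  have hset : {t : ℝ≥0 | ∀ u ≤ t, r.1 u = s.1 u} = {t | r.1 t = s.1 t} :=
    Set.ext fun t => ⟨fun ht => ht t le_rfl, fun ht u hu => agree_of_le ht hu⟩
  have hb := bddAbove_common h
  rw [hset] at hb
  unfold common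
  rw [hset]
  exact hc.csSup_mem ⟨0, r.2.2.trans s.2.2.symm⟩ hb

lemma le_common {r s : Ray (root T)} (h : r ≠ s) {c : ℝ≥0} (hc : r.1 c = s.1 c) :
    c ≤ common r s :=
  le_csSup (bddAbove_common h) fun _ hu => agree_of_le hc hu

lemma dist_of_ne {r s : Ray (root T)} (h : r ≠ s) :
    dist r s = Real.exp (-(common r s : ℝ)) := if_neg h

/-- Closed balls of ∂X are cylinders, since the supremum defining `common` is attained. From here on
the boundary metric is handled through agreement at a parameter. -/
lemma dist_le_exp_iff {r s : Ray (root T)} {c : ℝ≥0} :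
    dist r s ≤ Real.exp (-(c : ℝ)) ↔ r.1 c = s.1 c := by
  by_cases h : r = s
  · subst h
    simp [Real.exp_nonneg]
  rw [dist_of_ne h, Real.exp_le_exp, neg_le_neg_iff, NNReal.coe_le_coe]
  exact ⟨fun hc => agree_of_le (agree_common r s) hc, le_common h⟩

/-- On the scale -log d, a factor e^n is a shift of the branching height by n. Equal rays have
infinite overlap, which no finite `c` detects as a distance, hence the separate hypothesis `hrs`. -/
lemma dist_le_exp_mul {r s r' s' : Ray (root T)} {n : ℝ≥0} (hrs : r = s → r' = s')
    (h : ∀ c, r.1 c = s.1 c → r'.1 (c - n) = s'.1 (c - n)) :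
    dist r' s' ≤ Real.exp n * dist r s := by
  by_cases hne : r = s
  · rw [hrs hne, dist_self]
    positivity
  · refine (dist_le_exp_iff.2 (h _ (agree_common r s))).trans ?_
    rw [dist_of_ne hne, ← Real.exp_add, Real.exp_le_exp]
    have h1 : common r s ≤ n + (common r s - n) := le_add_tsub
    rw [← NNReal.coe_le_coe] at h1
    push_cast at h1
    linarith

lemma agree_sub_of_dist_le {r s r' s' : Ray (root T)} {n : ℝ≥0}
    (h : dist r' s' ≤ Real.exp n * dist r s) {c : ℝ≥0} (hc : r.1 c = s.1 c) :
    r'.1 (c - n) = s'.1 (c - n) := by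
  rcases le_total c n with hcn | hcn
  · rw [tsub_eq_zero_of_le hcn, r'.2.2, s'.2.2]
  rw [← dist_le_exp_iff]
  refine h.trans ((mul_le_mul_of_nonneg_left (dist_le_exp_iff.2 hc) (Real.exp_nonneg _)).trans ?_)
  rw [← Real.exp_add, Real.exp_le_exp, NNReal.coe_sub hcn]
  linarith

/-- To compare at v, use the bound at v + C: losing C in height still leaves agreement at v. -/
lemma eq_of_forall_dist_le {r s : Ray (root T)} {C : ℝ} (h : ∀ u, dist (r.1 u) (s.1 u) ≤ C) :
    r = s := by
  refine Subtype.ext (funext fun v => ?_)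
  have hC : C ≤ 2 * C.toNNReal := by
    have h1 := Real.le_coe_toNNReal C
    have h2 := C.toNNReal.coe_nonneg
    linarith
  simpa using sub_le_of_dist_le ((h (v + C.toNNReal)).trans hC)

lemma Matched.right_unique {ρ : DoubleMetric (TreeSpace T)} {r t t' : Ray (root T)}
    (h : Matched ρ r t) (h' : Matched ρ r t') : t = t' := by
  obtain ⟨C, hC⟩ := h
  obtain ⟨D, hD⟩ := h'
  exact eq_of_forall_dist_le fun u => (ρ.dist_le_right (r.1 u) _ _).trans (add_le_add (hC u) (hD u))

lemma Related.right_unique {s : MetricClass (TreeSpace T)} {r t t' : Ray (root T)}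
    (h : Related s r t) (h' : Related s r t') : t = t' := by
  induction s using Quotient.inductionOn with
  | h ρ => exact (Related.matched h).right_unique (Related.matched h')

lemma Related.left_unique {s : MetricClass (TreeSpace T)} {r r' t : Ray (root T)}
    (h : Related s r t) (h' : Related s r' t) : r = r' :=
  h.star.right_unique h'.star

/-- At each parameter the rays take finitely many values, so the ultrafilter selects one of them.
Isometry and base point involve at most two parameters at a time and are read off from a single ray
in the filter. -/
lemma exists_limit (hfin : ∀ v : T, {w : T | v ⋖ w}.Finite) (U : Ultrafilter (Ray (root T))) :
    ∃ r : Ray (root T), ∀ u, ∀ᶠ q in (U : Filter (Ray (root T))), q.1 u = r.1 u := by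
  have key : ∀ u : ℝ≥0, ∃ p, ∀ᶠ q in (U : Filter (Ray (root T))), q.1 u = p := by
    intro u
    have h : (⋃ p ∈ {p : TreeSpace T | p.height = u}, {q : Ray (root T) | q.1 u = p}) ∈ U :=
      Filter.mem_of_superset Filter.univ_mem fun q _ =>
        Set.mem_biUnion (x := q.1 u) (q.height_apply u) rfl
    obtain ⟨p, -, hp⟩ := (Ultrafilter.finite_biUnion_mem_iff (finite_height_eq hfin u)).1 h
    exact ⟨p, hp⟩
  choose p hp using key
  refine ⟨⟨p, Isometry.of_dist_eq fun u v => ?_, ?_⟩, hp⟩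
  · obtain ⟨q, h1, h2⟩ := ((hp u).and (hp v)).exists
    rw [← h1, ← h2, q.2.1.dist_eq]
  · obtain ⟨q, h1⟩ := (hp 0).exists
    rw [← h1, q.2.2]

lemma le_nhds_of_forall_eventually {F : Filter (Ray (root T))} {r : Ray (root T)}
    (h : ∀ u, ∀ᶠ q in F, q.1 u = r.1 u) : F ≤ nhds r := by
  refine Metric.nhds_basis_closedBall.ge_iff.2 fun ε hε => ?_
  filter_upwards [h (-Real.log ε).toNNReal] with q hq
  refine (dist_le_exp_iff.2 hq).trans ?_
  rw [← Real.le_log_iff_exp_le hε, neg_le]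
  exact Real.le_coe_toNNReal _

/-- The rays matched by `ρ` at distance at most `C` form a compact set. -/
lemma isCompact_setOf_matched (hfin : ∀ v : T, {w : T | v ⋖ w}.Finite)
    (ρ : DoubleMetric (TreeSpace T)) (C : ℝ) :
    IsCompact {r : Ray (root T) | ∃ t : Ray (root T), ∀ u, ρ.cross (r.1 u) (t.1 u) ≤ C} := by
  rw [isCompact_iff_ultrafilter_le_nhds]
  intro U hU
  rw [Filter.le_principal_iff] at hU
  obtain ⟨r, hr⟩ := exists_limit hfin U
  classical
  -- Choose a partner for each ray of the set; the value elsewhere is irrelevant. The limit of the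
  -- partners will be the partner of the limit, as for each u some q realises both limits at u
  -- exactly.
  let f : Ray (root T) → Ray (root T) := fun q =>
    if h : ∃ t : Ray (root T), ∀ u, ρ.cross (q.1 u) (t.1 u) ≤ C then h.choose else q
  obtain ⟨t, ht⟩ := exists_limit hfin (U.map f)
  refine ⟨r, ⟨t, fun u => ?_⟩, le_nhds_of_forall_eventually hr⟩
  have ht' : ∀ᶠ q in (U : Filter (Ray (root T))), (f q).1 u = t.1 u := ht u
  obtain ⟨q, ⟨h1, h2⟩, h3⟩ := (((hr u).and ht').and hU).exists
  have h4 : f q = h3.choose := dif_pos h3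
  have h5 := h3.choose_spec u
  rwa [← h4, h1, h2] at h5

end Ray

/-! ### From metric classes to partial maps of the boundary. -/

noncomputable section

/-- The partial bijection whose graph is a given functional and injective relation. -/
def PEquiv.ofRel {α β : Type*} (R : α → β → Prop) (h1 : ∀ a b b', R a b → R a b' → b = b')
    (h2 : ∀ a a' b, R a b → R a' b → a = a') : α ≃. β :=
  open Classical in
  { toFun := fun a => if h : ∃ b, R a b then some h.choose else none
    invFun := fun b => if h : ∃ a, R a b then some h.choose else none
    inv := by
      intro a b
      have e1 : ∀ h : ∃ a, R a b, (h.choose = a ↔ R a b) := fun h =>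
        ⟨fun e => e ▸ h.choose_spec, fun e => h2 _ _ _ h.choose_spec e⟩
      have e2 : ∀ h : ∃ b, R a b, (h.choose = b ↔ R a b) := fun h =>
        ⟨fun e => e ▸ h.choose_spec, fun e => h1 _ _ _ h.choose_spec e⟩
      by_cases hR : R a b
      · rw [dif_pos ⟨a, hR⟩, dif_pos ⟨b, hR⟩]
        simp [e1 ⟨a, hR⟩, e2 ⟨b, hR⟩]
      · constructor
        · intro h
          split_ifs at h with h'
          · exact absurd ((e1 h').1 (Option.some_injective _ h)) hR
        · intro h
          split_ifs at h with h'
          · exact absurd ((e2 h').1 (Option.some_injective _ h)) hR }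

lemma PEquiv.mem_ofRel {α β : Type*} {R : α → β → Prop} {h1 : ∀ a b b', R a b → R a b' → b = b'}
    {h2 : ∀ a a' b, R a b → R a' b → a = a'} {a : α} {b : β} :
    b ∈ PEquiv.ofRel R h1 h2 a ↔ R a b := by
  classical
  change (if h : ∃ b, R a b then some h.choose else none) = some b ↔ _
  constructor
  · intro h
    split_ifs at h with h'
    · exact Option.some_injective _ h ▸ h'.choose_spec
  · intro h
    rw [dif_pos ⟨b, h⟩]
    exact congrArg some (h1 _ _ _ (Exists.choose_spec ⟨b, h⟩) h)

lemma Ray.star_idem {X : Type*} [MetricSpace X] {x₀ : X} (r : Ray x₀) : star r.idem = r.idem :=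
  MetricClass.star_ofSet _ _

lemma mem_pdom {Y : Type*} [MetricSpace Y] {f : Y ≃. Y} {x : Y} : x ∈ pdom f ↔ ∃ y, y ∈ f x :=
  Option.isSome_iff_exists

namespace Ray

variable {T : RootedTree}

open TreeSpace

/-- The partial bijection of the boundary given by the class `s`. -/
def partialMap (s : MetricClass (TreeSpace T)) : Ray (root T) ≃. Ray (root T) :=
  PEquiv.ofRel (Related s) (fun _ _ _ h h' => h.right_unique h')
    (fun _ _ _ h h' => h.left_unique h')

lemma mem_partialMap {s : MetricClass (TreeSpace T)} {r t : Ray (root T)} :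
    t ∈ partialMap s r ↔ Related s r t :=
  PEquiv.mem_ofRel

lemma partialMap_star (s : MetricClass (TreeSpace T)) :
    partialMap (star s) = (partialMap s).symm := by
  refine PEquiv.ext fun r => Option.ext fun t => ?_
  rw [← Option.mem_def, ← Option.mem_def, mem_partialMap, related_star_iff,
    PEquiv.mem_iff_mem, mem_partialMap]

/-- If two rays matched with constant n agree at c, their partners are within 2n at c and so agree
at c - n. This is the Lipschitz bound e^n on the n-th compact set, and these sets exhaust the
domain. -/
lemma isLocLipschitz_partialMap (hfin : ∀ v : T, {w : T | v ⋖ w}.Finite)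
    (s : MetricClass (TreeSpace T)) :
    IsLocLipschitz (partialMap (T := T) s) := by
  induction s using Quotient.inductionOn with
  | h ρ =>
    have hmem : ∀ {r t : Ray (root T)},
        t ∈ partialMap (Quotient.mk _ ρ) r ↔ Matched ρ r t :=
      mem_partialMap.trans related_mk
    refine ⟨fun n => {r | ∃ t : Ray (root T), ∀ u, ρ.cross (r.1 u) (t.1 u) ≤ n},
      fun n => isCompact_setOf_matched hfin ρ n, ?_, fun n => ⟨Real.exp (n : ℝ≥0), ?_⟩⟩
    · ext r
      rw [mem_pdom, Set.mem_iUnion]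
      constructor
      · rintro ⟨t, ht⟩
        obtain ⟨C, hC⟩ := hmem.1 ht
        obtain ⟨n, hn⟩ := exists_nat_ge C
        exact ⟨n, t, fun u => (hC u).trans hn⟩
      · rintro ⟨n, t, ht⟩
        exact ⟨t, hmem.2 ⟨n, ht⟩⟩
    · rintro r ⟨q, hq⟩ r' ⟨q', hq'⟩ t ht t' ht'
      obtain rfl := (hmem.1 ht).right_unique ⟨n, hq⟩
      obtain rfl := (hmem.1 ht').right_unique ⟨n, hq'⟩
      refine dist_le_exp_mul ?_ fun c hc => sub_le_of_dist_le ?_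
      · rintro rfl
        exact (hmem.1 ht).right_unique (hmem.1 ht')
      · have h1 := ρ.dist_le_right (r.1 c) (t.1 c) (t'.1 c)
        have h2 := hq c
        have h3 := hq' c
        rw [← hc] at h3
        rw [NNReal.coe_natCast]
        linarith

/-- The element of `PBLBL(∂X)` given by the class `s`. -/
def toPBLBL (hfin : ∀ v : T, {w : T | v ⋖ w}.Finite) (s : MetricClass (TreeSpace T)) :
    PBLBL (Ray (root T)) where
  toPEquiv := partialMap s
  fsigma_dom := (isLocLipschitz_partialMap hfin s).isFSigma
  fsigma_range := by
    rw [← partialMap_star]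
    exact (isLocLipschitz_partialMap hfin _).isFSigma
  locLipschitz := isLocLipschitz_partialMap hfin s
  locLipschitz_symm := by
    rw [← partialMap_star]
    exact isLocLipschitz_partialMap hfin _

/-- On elements of `S(Φ)` the equalities of `Related s r t` follow from `e_r s* s ≠ 0`. -/
lemma exists_related_of_ne_zero {s : MetricClass (TreeSpace T)}
    (hs : s ∈ halfRestricted (Set.range (Ray.idem (x₀ := root T)))) {r : Ray (root T)}
    (h : r.idem * star s * s ≠ 0) : ∃ t : Ray (root T), Related s r t := by
  rcases hs r.idem ⟨r, rfl⟩ with h0 | ⟨h1, _, ⟨t, rfl⟩, h2, h3⟩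
  · exact absurd h0 h
  · exact ⟨t, h1, h2, h3⟩

/-- The forward direction is where the restriction on `s` and `s'` enters. Since e_r (ss')*(ss') =
e_r ≠ 0, also e_r s'*s' ≠ 0, which gives q. Moving e_r past s'* turns it into e_q, so e_q s*s ≠ 0,
which gives a partner of q. It equals `t` by uniqueness. -/
lemma related_mul_iff {s s' : MetricClass (TreeSpace T)}
    (hs : s ∈ halfRestricted (Set.range (Ray.idem (x₀ := root T))))
    (hs' : s' ∈ halfRestricted (Set.range (Ray.idem (x₀ := root T)))) {r t : Ray (root T)} :
    Related (s * s') r t ↔ ∃ q : Ray (root T), Related s' r q ∧ Related s q t := by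
  refine ⟨fun h => ?_, fun ⟨q, h1, h2⟩ => h1.mul h2⟩
  have hne : r.idem * star (s * s') * (s * s') ≠ 0 := by
    rw [h.1]
    exact r.idem_ne_zero
  obtain ⟨q, hq⟩ := exists_related_of_ne_zero hs' (r := r) (by
    intro h0
    apply hne
    have hr := MetricClass.mul_star_mul (star s')
    rw [star_star] at hr
    calc r.idem * star (s * s') * (s * s') = r.idem * star s' * (star s * s * s') := by
          simp only [star_mul, mul_assoc]
      _ = r.idem * (star s' * s' * star s') * (star s * s * s') := by rw [hr]
      _ = (r.idem * star s' * s') * (star s' * (star s * s * s')) := by simp only [mul_assoc]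
      _ = 0 := by rw [h0, zero_mul])
  obtain ⟨t', ht'⟩ := exists_related_of_ne_zero hs (r := q) (by
    intro h0
    apply hne
    have hst : r.idem * star s' = star s' * q.idem := by
      have h3 := congrArg star hq.2.1
      rwa [star_mul, star_mul, star_idem, star_idem] at h3
    calc r.idem * star (s * s') * (s * s') = (r.idem * star s') * (star s * s * s') := by
          simp only [star_mul, mul_assoc]
      _ = star s' * (q.idem * star s * s) * s' := by rw [hst]; simp only [mul_assoc]
      _ = 0 := by rw [h0, mul_zero, zero_mul])
  exact ⟨q, hq, h.right_unique (hq.mul ht') ▸ ht'⟩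

/-- The natural homomorphism from `M(X)_r` to `PBLBL(∂X)`. -/
def boundaryHom (hfin : ∀ v : T, {w : T | v ⋖ w}.Finite) :
    raySemigroup (root T) →ₙ* PBLBL (Ray (root T)) where
  toFun s := toPBLBL hfin s
  map_mul' s s' := by
    refine PBLBL.ext (PEquiv.ext fun r => Option.ext fun t => ?_)
    change t ∈ partialMap (s.1 * s'.1) r ↔ t ∈ (partialMap s'.1).trans (partialMap s.1) r
    rw [mem_partialMap, PEquiv.mem_trans, related_mul_iff s.2.1 s'.2.1]
    simp only [mem_partialMap]

end Ray
end

/-! ### Metrics realising partial maps of the boundary. -/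

noncomputable section

namespace DoubleMetric

variable {X : Type*} [MetricSpace X]

/-- The metric `ρ(x, y') = inf [d(x, a) + w + d(b, y)]`, the infimum over the triples `(a, b, w)` of
a set whose weights `w` bound the distortion of the correspondence between `a` and `b`. -/
def ofTriples (S : Set (X × X × ℝ)) (hS : S.Nonempty) (hw : ∀ p ∈ S, 1 ≤ p.2.2)
    (h1 : ∀ p ∈ S, ∀ q ∈ S, dist p.1 q.1 ≤ dist p.2.1 q.2.1 + (p.2.2 + q.2.2))
    (h2 : ∀ p ∈ S, ∀ q ∈ S, dist p.2.1 q.2.1 ≤ dist p.1 q.1 + (p.2.2 + q.2.2)) :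
    DoubleMetric X :=
  have : Nonempty S := hS.to_subtype
  have pos : ∀ (x y : X) (p : S), 1 ≤ dist x p.1.1 + p.1.2.2 + dist p.1.2.1 y := fun x y p => by
    have := hw p p.2
    have := dist_nonneg (x := x) (y := p.1.1)
    have := dist_nonneg (x := p.1.2.1) (y := y)
    linarith
  have bdd : ∀ x y : X, BddBelow (Set.range fun p : S => dist x p.1.1 + p.1.2.2 + dist p.1.2.1 y) :=
    fun x y => ⟨1, by rintro _ ⟨p, rfl⟩; exact pos x y p⟩
  ofCross (fun x y => ⨅ p : S, (dist x p.1.1 + p.1.2.2 + dist p.1.2.1 y))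
    (fun x x' y => by
      rw [← sub_le_iff_le_add']
      refine le_ciInf fun p => ?_
      rw [sub_le_iff_le_add']
      refine (ciInf_le (bdd x y) p).trans ?_
      have := dist_triangle x x' p.1.1
      linarith)
    (fun x y y' => by
      rw [← sub_le_iff_le_add]
      refine le_ciInf fun p => ?_
      rw [sub_le_iff_le_add]
      refine (ciInf_le (bdd x y) p).trans ?_
      have := dist_triangle p.1.2.1 y' y
      linarith)
    (fun x x' y => by
      rw [← sub_le_iff_le_add]
      refine le_ciInf fun p => ?_
      rw [sub_le_iff_le_add, ← sub_le_iff_le_add']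
      refine le_ciInf fun q => ?_
      rw [sub_le_iff_le_add']
      have e1 := dist_triangle4 x p.1.1 q.1.1 x'
      have e2 := dist_triangle p.1.2.1 y q.1.2.1
      have e3 := h1 p p.2 q q.2
      rw [dist_comm q.1.1 x'] at e1
      rw [dist_comm y q.1.2.1] at e2
      linarith)
    (fun x y y' => by
      rw [← sub_le_iff_le_add]
      refine le_ciInf fun p => ?_
      rw [sub_le_iff_le_add, ← sub_le_iff_le_add']
      refine le_ciInf fun q => ?_
      rw [sub_le_iff_le_add']
      have e1 := dist_triangle4 y p.1.2.1 q.1.2.1 y'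
      have e2 := dist_triangle p.1.1 x q.1.1
      have e3 := h2 p p.2 q q.2
      rw [dist_comm y p.1.2.1] at e1
      rw [dist_comm p.1.1 x] at e2
      linarith)
    ⟨1, one_pos, fun x y => le_ciInf fun p => pos x y p⟩

section ofTriples

variable {S : Set (X × X × ℝ)} {hS : S.Nonempty} {hw : ∀ p ∈ S, 1 ≤ p.2.2}
    {h1 : ∀ p ∈ S, ∀ q ∈ S, dist p.1 q.1 ≤ dist p.2.1 q.2.1 + (p.2.2 + q.2.2)}
    {h2 : ∀ p ∈ S, ∀ q ∈ S, dist p.2.1 q.2.1 ≤ dist p.1 q.1 + (p.2.2 + q.2.2)}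

lemma ofTriples_cross_le {p : X × X × ℝ} (hp : p ∈ S) :
    (ofTriples S hS hw h1 h2).cross p.1 p.2.1 ≤ p.2.2 := by
  have h := ciInf_le (f := fun q : S => dist p.1 q.1.1 + q.1.2.2 + dist q.1.2.1 p.2.1)
    ⟨0, by
      rintro _ ⟨q, rfl⟩
      have := hw q q.2
      positivity⟩ ⟨p, hp⟩
  refine h.trans_eq ?_
  simp only [dist_self, zero_add, add_zero]

lemma exists_ofTriples_cross_lt {x y : X} {C : ℝ}
    (h : (ofTriples S hS hw h1 h2).cross x y < C) :
    ∃ p ∈ S, dist x p.1 + p.2.2 + dist p.2.1 y < C := by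
  have : Nonempty S := hS.to_subtype
  obtain ⟨p, hp⟩ := exists_lt_of_ciInf_lt h
  exact ⟨p, p.2, hp⟩

end ofTriples

end DoubleMetric

namespace Ray

variable {T : RootedTree}

open TreeSpace

/-- Some ball of radius ε around r misses F, which bounds the overlap of r with rays of F by -log ε.
-/
lemma exists_agree_le_of_notMem {F : Set (Ray (root T))} (hF : IsClosed F) {r : Ray (root T)}
    (hr : r ∉ F) : ∃ M : ℝ≥0, ∀ q ∈ F, ∀ c, r.1 c = q.1 c → c ≤ M := by
  obtain ⟨ε, hε, hball⟩ := Metric.isOpen_iff.1 hF.isOpen_compl r hr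
  refine ⟨(-Real.log ε).toNNReal, fun q hq c hc => ?_⟩
  have h1 : ε ≤ dist r q := by
    by_contra! hlt
    exact hball (Metric.mem_ball'.2 hlt) hq
  have h2 := Real.log_le_log hε (h1.trans (dist_le_exp_iff.2 hc))
  rw [Real.log_exp] at h2
  rw [← NNReal.coe_le_coe]
  exact (le_neg.1 h2).trans (Real.le_coe_toNNReal _)

/-- By the tripod formula the distance is at least u - m, and m is bounded by the overlap. Thus r
moves away from all rays of F at unit speed. -/
lemma exists_le_add_dist_of_notMem {F : Set (Ray (root T))} (hF : IsClosed F) {r : Ray (root T)}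
    (hr : r ∉ F) : ∃ M : ℝ, ∀ q ∈ F, ∀ u v : ℝ≥0, (u : ℝ) ≤ M + dist (r.1 u) (q.1 v) := by
  obtain ⟨M, hM⟩ := exists_agree_le_of_notMem hF hr
  refine ⟨M, fun q hq u v => ?_⟩
  obtain ⟨m, -, hmv, hm, hd⟩ := r.exists_agree q u v
  have h1 : (m : ℝ) ≤ M := by exact_mod_cast hM q hq m hm
  have h2 : (m : ℝ) ≤ v := by exact_mod_cast hmv
  linarith

/-- A locally Lipschitz partial bijection moves the branching points towards the root by an amount
bounded by weights whose sublevel sets lie in closed subsets of the domain. -/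
lemma exists_weight {f : Ray (root T) ≃. Ray (root T)} (hf : IsLocLipschitz f) :
    ∃ w : Ray (root T) → ℝ≥0,
      (∀ C : ℝ, ∃ F : Set (Ray (root T)), IsClosed F ∧ F ⊆ pdom f ∧
        ∀ r ∈ pdom f, (w r : ℝ) ≤ C → r ∈ F) ∧
      ∀ r r' t t', t ∈ f r → t' ∈ f r' → ∀ c, r.1 c = r'.1 c →
        t.1 (c - (w r + w r')) = t'.1 (c - (w r + w r')) := by
  classical
  obtain ⟨K, hK, hU, hL⟩ := hf
  choose C hC using hL
  have hv : ∀ (r : Ray (root T)) (j : ℕ), ∃ M : ℝ≥0, r ∉ K j → ∀ q ∈ K j, ∀ c, r.1 c = q.1 c →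
      c ≤ M := by
    intro r j
    by_cases h : r ∈ K j
    · exact ⟨0, fun h' => absurd h h'⟩
    · obtain ⟨M, hM⟩ := exists_agree_le_of_notMem (hK j).isClosed h
      exact ⟨M, fun _ => hM⟩
  choose v hv using hv
  have hex : ∀ {r}, r ∈ pdom f → ∃ n, r ∈ K n := fun {r} hr => by
    rw [hU] at hr
    exact Set.mem_iUnion.1 hr
  -- The index of the first compact set containing r, with 0 as a default off the domain.
  let i : Ray (root T) → ℕ := fun r => if h : ∃ n, r ∈ K n then Nat.find h else 0
  have hi : ∀ {r}, r ∈ pdom f → r ∈ K (i r) := fun {r} hr => by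
    simp only [i, dif_pos (hex hr)]
    exact Nat.find_spec (hex hr)
  have hlt : ∀ {r}, r ∈ pdom f → ∀ j < i r, r ∉ K j := fun {r} hr j hj => by
    simp only [i, dif_pos (hex hr)] at hj
    exact Nat.find_min (hex hr) hj
  -- The index confines sublevel sets to finitely many K n. The Lipschitz constant handles pairs
  -- with the same index. The sum bounds the overlap of r with rays of smaller index, so for such
  -- pairs the shifted parameter is 0 and agreement is trivial.
  let w : Ray (root T) → ℝ≥0 := fun r =>
    i r + (C (i r)).toNNReal + ∑ j ∈ Finset.range (i r), v r j
  have hsep : ∀ r r', r ∈ pdom f → r' ∈ pdom f → i r' < i r → ∀ c, r.1 c = r'.1 c → c ≤ w r := by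
    intro r r' hr hr' hii c hc
    refine (hv r (i r') (hlt hr _ hii) r' (hi hr') c hc).trans ?_
    exact (Finset.single_le_sum (f := fun j => v r j) (fun _ _ => zero_le)
      (Finset.mem_range.2 hii)).trans le_add_self
  refine ⟨w, fun B => ?_, fun r r' t t' ht ht' c hc => ?_⟩
  · refine ⟨⋃ n ∈ Finset.range (⌈B⌉₊ + 1), K n,
      isClosed_biUnion_finset fun n _ => (hK n).isClosed, ?_, fun r hr hB => ?_⟩
    · rw [hU]
      exact Set.iUnion₂_subset fun n _ => Set.subset_iUnion K n
    · refine Set.mem_biUnion (x := i r) ?_ (hi hr)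
      have h1 : ((i r : ℝ≥0) : ℝ) ≤ w r := by
        exact_mod_cast (le_self_add.trans le_self_add : (i r : ℝ≥0) ≤ w r)
      have h2 : ((i r : ℕ) : ℝ) ≤ ⌈B⌉₊ := by
        simpa using (h1.trans hB).trans (Nat.le_ceil B)
      have h3 : i r ≤ ⌈B⌉₊ := by exact_mod_cast h2
      exact Finset.mem_coe.2 (Finset.mem_range.2 (by omega))
  · have hr : r ∈ pdom f := mem_pdom.2 ⟨t, ht⟩
    have hr' : r' ∈ pdom f := mem_pdom.2 ⟨t', ht'⟩
    have hzero : c ≤ w r + w r' → t.1 (c - (w r + w r')) = t'.1 (c - (w r + w r')) := fun h => by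
      rw [tsub_eq_zero_of_le h, t.2.2, t'.2.2]
    rcases lt_trichotomy (i r) (i r') with h | h | h
    · exact hzero ((hsep r' r hr' hr h c hc.symm).trans le_add_self)
    · refine agree_sub_of_dist_le (r := r) (s := r') ?_ hc
      have hr'' : r' ∈ K (i r) := h ▸ hi hr'
      refine (hC (i r) r (hi hr) r' hr'' t ht t' ht').trans ?_
      -- A shift by log C would suffice; using C itself is enough because C ≤ e^C.
      refine mul_le_mul_of_nonneg_right ?_ dist_nonneg
      have h1 : (C (i r)).toNNReal ≤ w r + w r' :=
        (le_add_self.trans le_self_add : (C (i r)).toNNReal ≤ w r).trans le_self_add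
      have h2 : ((C (i r)).toNNReal : ℝ) ≤ ((w r + w r' : ℝ≥0) : ℝ) := by exact_mod_cast h1
      have h3 := Real.add_one_le_exp ((w r + w r' : ℝ≥0) : ℝ)
      have h4 := Real.le_coe_toNNReal (C (i r))
      linarith
    · exact hzero ((hsep r r' hr hr' h c hc).trans le_self_add)

/-- Lowering the branching point by n lengthens the path through it by 2n. This is the source of the
factor 2 in `graphTriples`. -/
lemma dist_le_of_agree_sub {r r' t t' : Ray (root T)} {n : ℝ≥0}
    (h : ∀ c, r.1 c = r'.1 c → t.1 (c - n) = t'.1 (c - n)) (u v : ℝ≥0) :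
    dist (t.1 u) (t'.1 v) ≤ dist (r.1 u) (r'.1 v) + 2 * n := by
  obtain ⟨m, hu, hv, hm, hd⟩ := r.exists_agree r' u v
  have h1 := dist_le_of_agree (h m hm) (tsub_le_self.trans hu) (tsub_le_self.trans hv)
  have h2 : (m : ℝ) ≤ ((m - n : ℝ≥0) : ℝ) + n := by exact_mod_cast le_tsub_add
  linarith

/-- The two alternatives of `halfRestricted` are realised by the two hypotheses: matching on the
domain, escape from sublevel sets off it. -/
lemma mk_mem_halfRestricted {f : Ray (root T) ≃. Ray (root T)} {ρ : DoubleMetric (TreeSpace T)}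
    (h1 : ∀ r t, t ∈ f r → Matched ρ r t)
    (h2 : ∀ r ∉ pdom f, ∀ C : ℝ, ∃ M : ℝ, ∀ u y, ρ.cross (r.1 u) y ≤ C → (u : ℝ) ≤ M) :
    MetricClass.mk ρ ∈ halfRestricted (Set.range (Ray.idem (x₀ := root T))) := by
  rintro _ ⟨r, rfl⟩
  by_cases hr : r ∈ pdom f
  · obtain ⟨t, ht⟩ := mem_pdom.1 hr
    obtain ⟨e1, e2, e3⟩ := (h1 r t ht).related
    exact Or.inr ⟨e1, t.idem, ⟨t, rfl⟩, e2, e3⟩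
  · exact Or.inl (idem_mul_star_mul_eq_zero (h2 r hr))

lemma partialMap_mk_eq {f : Ray (root T) ≃. Ray (root T)} {ρ : DoubleMetric (TreeSpace T)}
    (h1 : ∀ r t, t ∈ f r → Matched ρ r t)
    (h2 : ∀ r ∉ pdom f, ∀ C : ℝ, ∃ M : ℝ, ∀ u y, ρ.cross (r.1 u) y ≤ C → (u : ℝ) ≤ M) :
    partialMap (MetricClass.mk ρ) = f := by
  refine PEquiv.ext fun r => Option.ext fun t => ?_
  rw [← Option.mem_def, ← Option.mem_def, mem_partialMap]
  refine ⟨fun h => ?_, fun h => (h1 r t h).related⟩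
  by_cases hr : r ∈ pdom f
  · obtain ⟨t', ht'⟩ := mem_pdom.1 hr
    rwa [(h1 r t' ht').related.right_unique h] at ht'
  · exact absurd (h.1.symm.trans (idem_mul_star_mul_eq_zero (h2 r hr))) r.idem_ne_zero

/-- The triples `(r u, (f r) u, w)` of a partial bijection `f`, together with the root. -/
def graphTriples (f : Ray (root T) ≃. Ray (root T)) (w w' : Ray (root T) → ℝ≥0) :
    Set (TreeSpace T × TreeSpace T × ℝ) :=
  {p | p = (root T, root T, 1) ∨
    ∃ r t u, t ∈ f r ∧ p = (r.1 u, t.1 u, 1 + 2 * ((w r : ℝ) + w' t))}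

/-- Every locally bi-Lipschitz partial bijection is realised by a metric on the double. -/
lemma exists_metric {f : Ray (root T) ≃. Ray (root T)} (hf : IsLocLipschitz f)
    (hf' : IsLocLipschitz f.symm) : ∃ ρ : DoubleMetric (TreeSpace T),
      (∀ r t, t ∈ f r → Matched ρ r t) ∧
      (∀ r ∉ pdom f, ∀ C : ℝ, ∃ M : ℝ, ∀ u y, ρ.cross (r.1 u) y ≤ C → (u : ℝ) ≤ M) ∧
      (∀ t ∉ pdom f.symm, ∀ C : ℝ, ∃ M : ℝ, ∀ u x, ρ.cross x (t.1 u) ≤ C → (u : ℝ) ≤ M) := by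
  obtain ⟨w, hF, hw⟩ := exists_weight hf
  obtain ⟨w', hF', hw'⟩ := exists_weight hf'
  have hw1 : ∀ p ∈ graphTriples f w w', 1 ≤ p.2.2 := by
    rintro _ (rfl | ⟨r, t, u, -, rfl⟩)
    · exact le_rfl
    · have := (w r).coe_nonneg
      have := (w' t).coe_nonneg
      simp only
      linarith
  have hsymm : ∀ {r t}, t ∈ f r → r ∈ f.symm t := fun h => (PEquiv.mem_iff_mem f).2 h
  have h1 : ∀ p ∈ graphTriples f w w', ∀ q ∈ graphTriples f w w',
      dist p.1 q.1 ≤ dist p.2.1 q.2.1 + (p.2.2 + q.2.2) := by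
    intro p hp q hq
    have hp1 := hw1 p hp
    have hq1 := hw1 q hq
    rcases hp with rfl | ⟨r, t, u, hrt, rfl⟩ <;> rcases hq with rfl | ⟨r', t', u', hrt', rfl⟩
    · simp
    · simp only [Ray.dist_root] at *
      linarith
    · simp only [dist_comm _ (root T), Ray.dist_root] at *
      linarith
    -- Distances between the first components are controlled by the inverse map, hence by `w'`; the
    -- reverse inequality below uses `w`. This is why the cost contains both.
    · have h := dist_le_of_agree_sub (hw' t t' r r' (hsymm hrt) (hsymm hrt')) u u'
      have := (w r).coe_nonneg
      have := (w r').coe_nonneg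
      push_cast at h
      simp only
      linarith
  have h2 : ∀ p ∈ graphTriples f w w', ∀ q ∈ graphTriples f w w',
      dist p.2.1 q.2.1 ≤ dist p.1 q.1 + (p.2.2 + q.2.2) := by
    intro p hp q hq
    have hp1 := hw1 p hp
    have hq1 := hw1 q hq
    rcases hp with rfl | ⟨r, t, u, hrt, rfl⟩ <;> rcases hq with rfl | ⟨r', t', u', hrt', rfl⟩
    · simp
    · simp only [Ray.dist_root] at *
      linarith
    · simp only [dist_comm _ (root T), Ray.dist_root] at *
      linarith
    · have h := dist_le_of_agree_sub (hw r r' t t' hrt hrt') u u'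
      have := (w' t).coe_nonneg
      have := (w' t').coe_nonneg
      push_cast at h
      simp only
      linarith
  -- The root triple keeps the set nonempty when `f` is empty; alone it gives the zero class.
  refine ⟨DoubleMetric.ofTriples (graphTriples f w w') ⟨_, Or.inl rfl⟩ hw1 h1 h2, ?_, ?_, ?_⟩
  · intro r t hrt
    exact ⟨1 + 2 * ((w r : ℝ) + w' t), fun u =>
      DoubleMetric.ofTriples_cross_le (p := (r.1 u, t.1 u, 1 + 2 * ((w r : ℝ) + w' t)))
        (Or.inr ⟨r, t, u, hrt, rfl⟩)⟩
  · intro r hr C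
    -- A path of cost below C + 1 uses either the root triple, which bounds u directly, or a ray q
    -- with w(q) ≤ C + 1. In the latter case q lies in a closed part of the domain, from which r
    -- moves away.
    obtain ⟨F, hFc, hFd, hFw⟩ := hF (C + 1)
    obtain ⟨M, hM⟩ := exists_le_add_dist_of_notMem hFc fun h => hr (hFd h)
    refine ⟨|M| + C + 1, fun u y huy => ?_⟩
    obtain ⟨p, hp, hlt⟩ := DoubleMetric.exists_ofTriples_cross_lt
      (lt_of_le_of_lt huy (lt_add_one C))
    have hM0 := le_abs_self M
    have hM1 := abs_nonneg M
    have hy : 0 ≤ dist p.2.1 y := dist_nonneg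
    have hx : 0 ≤ dist (r.1 u) p.1 := dist_nonneg
    have hp1 := hw1 p hp
    rcases hp with rfl | ⟨q, t, v, hqt, rfl⟩
    · rw [dist_comm, Ray.dist_root] at hlt
      simp only at *
      linarith
    · simp only at *
      have e1 := (w q).coe_nonneg
      have e2 := (w' t).coe_nonneg
      have e3 := hM q (hFw q (mem_pdom.2 ⟨t, hqt⟩) (by linarith)) u v
      linarith
  · intro t ht C
    obtain ⟨F, hFc, hFd, hFw⟩ := hF' (C + 1)
    obtain ⟨M, hM⟩ := exists_le_add_dist_of_notMem hFc fun h => ht (hFd h)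
    refine ⟨|M| + C + 1, fun u x hux => ?_⟩
    obtain ⟨p, hp, hlt⟩ := DoubleMetric.exists_ofTriples_cross_lt
      (lt_of_le_of_lt hux (lt_add_one C))
    rw [dist_comm p.2.1] at hlt
    have hM0 := le_abs_self M
    have hM1 := abs_nonneg M
    have hy : 0 ≤ dist (t.1 u) p.2.1 := dist_nonneg
    have hx : 0 ≤ dist x p.1 := dist_nonneg
    have hp1 := hw1 p hp
    rcases hp with rfl | ⟨r, q, v, hrq, rfl⟩
    · rw [dist_comm (t.1 u), Ray.dist_root] at hlt
      simp only at *
      linarith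
    · simp only at *
      have e1 := (w r).coe_nonneg
      have e2 := (w' q).coe_nonneg
      have e3 := hM q (hFw q (mem_pdom.2 ⟨r, hsymm hrq⟩) (by linarith)) u v
      linarith

lemma exists_boundaryHom_eq (hfin : ∀ v : T, {w : T | v ⋖ w}.Finite)
    (φ : PBLBL (Ray (root T))) : ∃ s : raySemigroup (root T), boundaryHom hfin s = φ := by
  obtain ⟨ρ, h1, h2, h3⟩ := exists_metric φ.locLipschitz φ.locLipschitz_symm
  refine ⟨⟨MetricClass.mk ρ, mk_mem_halfRestricted h1 h2, ?_⟩,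
    PBLBL.ext (partialMap_mk_eq h1 h2)⟩
  -- The adjoint metric realises the inverse partial map, so membership of the adjoint class follows
  -- from the escape property on the range side.
  exact mk_mem_halfRestricted (ρ := ρ.adjoint)
    (fun t r h => (h1 r t ((PEquiv.mem_iff_mem _).1 h)).adjoint) h3

end Ray

end

theorem mainTheorem2 (T : RootedTree)
    (hfin : ∀ v : T, {w : T | v ⋖ w}.Finite)
    (hdead : ∀ p : TreeSpace T, ∃ r : Ray (TreeSpace.root T), p ∈ r.image) :
    ∃ ψ : raySemigroup (TreeSpace.root T) →ₙ* PBLBL (Ray (TreeSpace.root T)),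
      (∀ (s : raySemigroup (TreeSpace.root T)) (r t : Ray (TreeSpace.root T)),
        t ∈ (ψ s).toPEquiv r ↔
          r.idem * star (s : MetricClass (TreeSpace T)) * s = r.idem ∧
          (s : MetricClass (TreeSpace T)) * r.idem = t.idem * s ∧
          t.idem * s * star (s : MetricClass (TreeSpace T)) = t.idem) ∧
      Function.Surjective ψ ∧
      ∃ χ : PBLBL (Ray (TreeSpace.root T)) → raySemigroup (TreeSpace.root T),
        ∀ φ, ψ (χ φ) = φ := by
  choose χ hχ using Ray.exists_boundaryHom_eq hfin
  exact ⟨Ray.boundaryHom hfin, fun s r t => Ray.mem_partialMap, fun φ => ⟨χ φ, hχ φ⟩, χ, hχ⟩
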